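/- Let $n\ge 0$, let $\lambda_1,\dots,\lambda_n$ be pairwise distinct real numbers and $\Lambda=\mathrm{diag}(\lambda_1,\dots,\lambda_n)$. For $\Psi\in SO_n(\mathbb R)$ put $L(\Psi)=\Psi\Lambda\Psi^{-1}$ and $A(\Psi)=L(\Psi)_+-L(\Psi)_-$, where $L_+$ and $L_-$ are the strictly upper and the strictly lower triangular parts of $L$. The full symmetric Toda flow on $SO_n(\mathbb R)$ is the flow $\dot\Psi=-A(\Psi)\Psi$. It commutes with right multiplication by the group $N$ of diagonal matrices in $SO_n(\mathbb R)$ (whose diagonal entries are $\pm1$), and so induces a flow on the flag manifold $Fl_n(\mathbb R)=SO_n(\mathbb R)/N$. (1) The singular points of the flow on $Fl_n(\mathbb R)$ correspond bijectively to the elements of the symmetric group $S_n$: the point $s_w$ attached to $w\in S_n$ is the class consisting of all $\Psi\in SO_n(\mathbb R)$ with $\Psi_{i,w(i)}=\pm1$ for all $i$ and all other entries zero, equivalently of all $\Psi\in SO_n(\mathbb R)$ with $L(\Psi)=\mathrm{diag}(\lambda_{w(1)},\dots,\lambda_{w(n)})$. (2) Let $\sigma\in S_n$ be the permutation with $\lambda_{\sigma(1)}<\lambda_{\sigma(2)}<\dots<\lambda_{\sigma(n)}$.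 For all $u,v\in S_n$, the singular points $s_u$ and $s_v$ are connected by a trajectory of the flow on $Fl_n(\mathbb R)$ (that is, there is a trajectory, defined for all $t\in\mathbb R$, that tends to one of them as $t\to-\infty$ and to the other one as $t\to+\infty$) if and only if $\sigma^{-1}u$ and $\sigma^{-1}v$ are comparable in the Bruhat order. Here the Bruhat order on $S_n$ is the partial order generated by the relations $x<y$ whenever $y=(i\,j)\,x$ for a transposition $(i\,j)$ and $\ell(y)=\ell(x)+1$, where $\ell(w)=\#\{i<j\mid w(i)>w(j)\}$; equal elements count as comparable, and constant trajectories are allowed. -/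

import Mathlib

open Filter Topology

noncomputable section

/-- The special orthogonal group `SO_n(ℝ)`, with the topology induced from the space of matrices. -/
abbrev SO (n : ℕ) : Type := Matrix.specialOrthogonalGroup (Fin n) ℝ

/-- The subgroup of diagonal matrices in `SO_n(ℝ)`.  Their diagonal entries are `±1`, and this is
also the intersection of `SO_n(ℝ)` with the group of upper triangular matrices. -/
def diagSigns (n : ℕ) : Subgroup (SO n) where
  carrier := {D | (D : Matrix (Fin n) (Fin n) ℝ).IsDiag}
  one_mem' := Matrix.isDiag_one
  mul_mem' := by
    intro a b ha hb i j hij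
    have h : (a : Matrix (Fin n) (Fin n) ℝ) = Matrix.diagonal (Matrix.diag a.1) :=
      ((Matrix.isDiag_iff_diagonal_diag _).1 ha).symm
    change ((a : Matrix (Fin n) (Fin n) ℝ) * (b : Matrix (Fin n) (Fin n) ℝ)) i j = 0
    rw [h, Matrix.diagonal_mul, hb hij, mul_zero]
  inv_mem' := by
    intro a ha
    exact Matrix.IsDiag.conjTranspose ha

/-- The flag manifold `Fl_n(ℝ)`, realised as the quotient of `SO_n(ℝ)` by the (right) action of the
diagonal sign matrices, with the quotient topology. -/
abbrev FlagManifold (n : ℕ) : Type := SO n ⧸ diagSigns n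

/-- The Lax matrix `L = Ψ Λ Ψ⁻¹`, where `Λ = diag(lam)`; note `Ψ⁻¹ = Ψᵀ` for orthogonal `Ψ`. -/
def laxMatrix {n : ℕ} (lam : Fin n → ℝ) (Ψ : SO n) : Matrix (Fin n) (Fin n) ℝ :=
  (Ψ : Matrix (Fin n) (Fin n) ℝ) * Matrix.diagonal lam *
    (Ψ : Matrix (Fin n) (Fin n) ℝ).transpose

/-- `A(L) = L₊ - L₋`: the strictly upper triangular part minus the strictly lower one. -/
def antisymmetrization {n : ℕ} (L : Matrix (Fin n) (Fin n) ℝ) : Matrix (Fin n) (Fin n) ℝ :=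
  Matrix.of fun i j => if i < j then L i j else if j < i then -L i j else 0

/-- The vector field `Ψ ↦ -A(Ψ) Ψ` of the full symmetric Toda flow on `SO_n(ℝ)`. -/
def todaField {n : ℕ} (lam : Fin n → ℝ) (Ψ : SO n) : Matrix (Fin n) (Fin n) ℝ :=
  -(antisymmetrization (laxMatrix lam Ψ) * (Ψ : Matrix (Fin n) (Fin n) ℝ))

/-- The singular points of the flow on the flag manifold: classes of zeros of the vector field. -/
def singularPoints {n : ℕ} (lam : Fin n → ℝ) : Set (FlagManifold n) :=
  {x | ∃ Ψ : SO n, (Ψ : FlagManifold n) = x ∧ todaField lam Ψ = 0}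

/-- An integral curve, defined for all times, of the Toda flow on `SO_n(ℝ)`. -/
def IsTodaSolution {n : ℕ} (lam : Fin n → ℝ) (Ψ : ℝ → SO n) : Prop :=
  ∀ (t : ℝ) (i j : Fin n),
    HasDerivAt (fun s => (Ψ s : Matrix (Fin n) (Fin n) ℝ) i j) (todaField lam (Ψ t) i j) t

/-- A trajectory of the induced flow on the flag manifold: the projection of an integral curve. -/
def IsTodaTrajectory {n : ℕ} (lam : Fin n → ℝ) (γ : ℝ → FlagManifold n) : Prop :=
  ∃ Ψ : ℝ → SO n, IsTodaSolution lam Ψ ∧ ∀ t, γ t = (Ψ t : FlagManifold n)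

/-- There is a trajectory going from `x` (as `t → -∞`) to `y` (as `t → +∞`). -/
def TrajectoryFromTo {n : ℕ} (lam : Fin n → ℝ) (x y : FlagManifold n) : Prop :=
  ∃ γ : ℝ → FlagManifold n, IsTodaTrajectory lam γ ∧
    Tendsto γ atBot (𝓝 x) ∧ Tendsto γ atTop (𝓝 y)

/-- `x` and `y` are connected by a trajectory (in one of the two directions). -/
def ConnectedByTrajectory {n : ℕ} (lam : Fin n → ℝ) (x y : FlagManifold n) : Prop :=
  TrajectoryFromTo lam x y ∨ TrajectoryFromTo lam y x

/-- The length of a permutation: its number of inversions. -/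
def permLength {n : ℕ} (w : Equiv.Perm (Fin n)) : ℕ :=
  (Finset.univ.filter fun p : Fin n × Fin n => p.1 < p.2 ∧ w p.2 < w p.1).card

/-- The generating relations of the Bruhat order: `y = (i j) x` with `ℓ(y) = ℓ(x) + 1`. -/
def BruhatStep {n : ℕ} (x y : Equiv.Perm (Fin n)) : Prop :=
  ∃ i j : Fin n, i ≠ j ∧ y = Equiv.swap i j * x ∧ permLength y = permLength x + 1

/-- The (non-strict) Bruhat order on `S_n`. -/
def BruhatLE {n : ℕ} (x y : Equiv.Perm (Fin n)) : Prop :=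
  Relation.ReflTransGen BruhatStep x y

/-- Comparability in the Bruhat order. -/
def BruhatComparable {n : ℕ} (x y : Equiv.Perm (Fin n)) : Prop :=
  BruhatLE x y ∨ BruhatLE y x

end

/-! ### Length of permutations and the counting criterion for the Bruhat order -/

section Combinatorics

/-! Write `-A(L) = L - R` with `R` upper triangular. Since `L Ψ = Ψ Λ`, the flow reads `Ψ' = ΨΛ -
RΨ`, and hence `Ψ(t) = G(t) Ψ(0) exp(tΛ)` with `G(t)` upper triangular
(`IsTodaSolution.blockTriangular_factor`). Up to an upper triangular left factor, the flow is right
multiplication by `exp(tΛ)`.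

Gaussian elimination by upper triangular row operations turns `Ψ(0)` into a matrix whose rows have
their dominant entries, with respect to the weights `lam`, in distinct columns; these columns form a
permutation (`HasPivots`). As `t → +∞` only the dominant entries survive, so the trajectory tends to
the singular point of that permutation (`IsTodaSolution.tendsto_atTop`). Time reversal replaces
`lam` by `-lam`, so the limit at `-∞` is given by the pivots for `-lam`.

The dynamics thus reduces to linear algebra: which pairs of permutations are the two pivot systems
of one invertible matrix, that is, which pairs of opposite Bruhat cells meet? A dimension count for
spans of rows gives the rank inequalities that characterise the Bruhat order
(`card_add_card_le_of_hasPivots`, `bruhatLE_of_card_le`). Conversely, a chain of Bruhat steps is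
followed starting from a permutation matrix, each step changing only one of the two pivot systems
(`exists_hasPivots_of_bruhatStep`). An `RQ` decomposition then moves the matrix into `SO n` without
changing its pivots, and completeness of the flow supplies the trajectory. -/

lemma permLength_cast_eq_sum {n : ℕ} (w : Equiv.Perm (Fin n)) :
    (permLength w : ℤ) = ∑ c, ∑ d, if c < d ∧ w d < w c then 1 else 0 := by
  rw [permLength, Finset.card_filter, Fintype.sum_prod_type]
  push_cast
  rfl

/-- Exchanging the values at two positions `i < j` with `x i < x j` increases the length by one plus
twice the number of intermediate entries. -/
lemma permLength_mul_swap {n : ℕ} (x : Equiv.Perm (Fin n)) {i j : Fin n} (hij : i < j)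
    (hx : x i < x j) :
    permLength (x * Equiv.swap i j) = permLength x + 1 +
      2 * (Finset.univ.filter fun m => i < m ∧ m < j ∧ x i < x m ∧ x m < x j).card := by
  zify
  rw [permLength_cast_eq_sum, permLength_cast_eq_sum, Finset.card_filter]
  set t := Equiv.swap i j with ht
  have hre : (∑ c, ∑ d, if c < d ∧ (x * t) d < (x * t) c then (1 : ℤ) else 0) =
      ∑ c, ∑ d, if t c < t d ∧ x d < x c then (1 : ℤ) else 0 := by
    rw [← Equiv.sum_comp t]
    refine Finset.sum_congr rfl fun c _ => ?_
    rw [← Equiv.sum_comp t]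
    refine Finset.sum_congr rfl fun d _ => ?_
    simp [ht]
  -- After reindexing, both lengths test `x d < x c` and differ only in the condition on positions.
  -- The corrections come from pairs meeting `{i, j}`.
  have hpt : ∀ c d, (if t c < t d ∧ x d < x c then (1 : ℤ) else 0) =
      (if c < d ∧ x d < x c then 1 else 0) + (if c = j then if d = i then 1 else 0 else 0)
      + (if c = i then if i < d ∧ d < j ∧ x d < x i then -1 else 0 else 0)
      + (if d = i then if i < c ∧ c < j ∧ x i < x c then 1 else 0 else 0)
      + (if c = j then if i < d ∧ d < j ∧ x d < x j then 1 else 0 else 0)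
      + (if d = j then if i < c ∧ c < j ∧ x j < x c then -1 else 0 else 0) := by
    intro c d
    have hi : t i = j := Equiv.swap_apply_left i j
    have hj : t j = i := Equiv.swap_apply_right i j
    have ho : ∀ m, m ≠ i → m ≠ j → t m = m := fun m => Equiv.swap_apply_of_ne_of_ne
    clear_value t
    have hji := hij.ne'
    have h1 := hij.not_gt
    have h2 := hx.not_gt
    rcases eq_or_ne c i with rfl | hci
    · rcases eq_or_ne d c with rfl | hdi
      · simp [hij.ne]
      · rcases eq_or_ne d j with rfl | hdj
        · simp [hi, hj, h1, h2, hij.ne, hji]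
        · simp only [hi, ho d hdi hdj, hij.ne, hdi, hdj, if_true, if_false]
          split_ifs <;> omega
    · rcases eq_or_ne c j with rfl | hcj
      · rcases eq_or_ne d i with rfl | hdi
        · simp [hi, hj, h1, hx, hij, hij.ne, hji]
        · rcases eq_or_ne d c with rfl | hdj
          · simp [hdi]
          · simp only [hj, ho d hdi hdj, hci, hdi, hdj, if_true, if_false]
            split_ifs <;> omega
      · rcases eq_or_ne d i with rfl | hdi
        · simp only [hi, ho c hci hcj, hci, hcj, hij.ne, if_true, if_false]
          split_ifs <;> omega
        · rcases eq_or_ne d j with rfl | hdj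
          · simp only [hj, ho c hci hcj, hci, hcj, hdi, if_true, if_false]
            split_ifs <;> omega
          · simp [ho c hci hcj, ho d hdi hdj, hci, hcj, hdi, hdj]
  have hm : ∀ m, (2 : ℤ) * (if i < m ∧ m < j ∧ x i < x m ∧ x m < x j then 1 else 0) =
      (if i < m ∧ m < j ∧ x m < x i then -1 else 0) +
      (if i < m ∧ m < j ∧ x i < x m then 1 else 0) +
      (if i < m ∧ m < j ∧ x m < x j then 1 else 0) +
      (if i < m ∧ m < j ∧ x j < x m then -1 else 0) := by
    intro m
    by_cases h : i < m ∧ m < j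
    · have h1 : x m ≠ x i := fun e => h.1.ne' (x.injective e)
      have h2 : x m ≠ x j := fun e => h.2.ne (x.injective e)
      simp only [h.1, h.2, true_and]
      split_ifs <;> omega
    · have h' : ∀ p : Prop, ¬ (i < m ∧ m < j ∧ p) := fun p hp => h ⟨hp.1, hp.2.1⟩
      simp [h']
  rw [hre]
  simp only [hpt]
  push_cast
  rw [Finset.mul_sum]
  simp only [hm, Finset.sum_add_distrib, Finset.sum_ite_irrel, Finset.sum_const_zero,
    Finset.sum_ite_eq', Finset.mem_univ, if_true]
  ring

lemma permLength_le {n : ℕ} (w : Equiv.Perm (Fin n)) : permLength w ≤ n * n := by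
  refine (Finset.card_filter_le _ _).trans ?_
  simp

/-- A left multiplication by a transposition which increases the length creates an inversion. -/
lemma symm_apply_lt_of_permLength_lt {n : ℕ} {x : Equiv.Perm (Fin n)} {a b : Fin n} (hab : a < b)
    (h : permLength x < permLength (Equiv.swap a b * x)) : x.symm a < x.symm b := by
  by_contra hlt
  have hne : x.symm b ≠ x.symm a := fun e => hab.ne' (x.symm.injective e)
  have hlt' : x.symm b < x.symm a := lt_of_le_of_ne (not_lt.1 hlt) hne
  have key := permLength_mul_swap (Equiv.swap a b * x) hlt' (by simpa using hab)
  have hx : Equiv.swap a b * x * Equiv.swap (x.symm b) (x.symm a) = x := by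
    ext m
    rw [Equiv.swap_comm (x.symm b)]
    simp [Equiv.Perm.mul_apply, Equiv.swap_apply_def, Equiv.eq_symm_apply]
    split_ifs <;> simp_all
  rw [hx] at key
  omega

/-- If `x ≠ y`, let `j` be the first position of disagreement; domination forces `x j < y j`.
Exchanging `x j` with the next later value in `(x j, y j]` is a Bruhat step that stays dominated by
`y`. The length is bounded, so the process ends at `y`. -/
lemma bruhatLE_of_card_le {n : ℕ} (y : Equiv.Perm (Fin n)) : ∀ x : Equiv.Perm (Fin n),
    (∀ (p : Fin n) (q : ℕ), (Finset.univ.filter fun a => a ≤ p ∧ q ≤ (x a : ℕ)).card ≤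
      (Finset.univ.filter fun a => a ≤ p ∧ q ≤ (y a : ℕ)).card) → BruhatLE x y := by
  suffices H : ∀ (N : ℕ) (x : Equiv.Perm (Fin n)), n * n - permLength x < N →
      (∀ (p : Fin n) (q : ℕ), (Finset.univ.filter fun a => a ≤ p ∧ q ≤ (x a : ℕ)).card ≤
        (Finset.univ.filter fun a => a ≤ p ∧ q ≤ (y a : ℕ)).card) → BruhatLE x y from
    fun x => H _ x (Nat.lt_succ_self _)
  intro N
  induction N with
  | zero => intro x h; omega
  | succ N ih =>
    intro x hN hd
    by_cases hxy : x = y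
    · subst hxy; exact Relation.ReflTransGen.refl
    have hex : ∃ j, x j ≠ y j := by
      by_contra! h
      exact hxy (Equiv.ext h)
    obtain ⟨j, hj, hjmin⟩ := WellFounded.has_min wellFounded_lt {j | x j ≠ y j} hex
    have hbelow : ∀ a, a < j → x a = y a := fun a ha => by
      by_contra h
      exact hjmin a h ha
    have hjy : x j < y j := by
      by_contra hle
      have hlt : y j < x j := lt_of_le_of_ne (not_lt.1 hle) (Ne.symm hj)
      refine absurd (hd j (x j)) (not_le.2 (Finset.card_lt_card ?_))
      refine Finset.ssubset_iff_subset_ne.2 ⟨?_, ?_⟩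
      · intro a ha
        simp only [Finset.mem_filter, Finset.mem_univ, true_and] at ha ⊢
        rcases ha.1.lt_or_eq with h | rfl
        · rw [hbelow a h]; exact ha
        · exact ⟨le_rfl, le_rfl⟩
      · intro he
        have : j ∈ Finset.univ.filter fun a => a ≤ j ∧ (x j : ℕ) ≤ (x a : ℕ) := by simp
        rw [← he] at this
        simp only [Finset.mem_filter, Finset.mem_univ, true_and] at this
        omega
    have hkex : ∃ k, j < k ∧ x j < x k ∧ x k ≤ y j := by
      refine ⟨x.symm (y j), ?_, by simpa using hjy, by simp⟩
      by_contra hle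
      rcases (not_lt.1 hle).lt_or_eq with h | h
      · have := hbelow _ h
        rw [Equiv.apply_symm_apply] at this
        exact h.ne' (y.injective this)
      · rw [Equiv.symm_apply_eq] at h
        exact hj h.symm
    obtain ⟨k, ⟨hjk, hxk, hky⟩, hkmin⟩ := WellFounded.has_min wellFounded_lt
      {k | j < k ∧ x j < x k ∧ x k ≤ y j} hkex
    have hgap : ∀ m, j < m → m < k → x m < x j ∨ y j < x m := by
      intro m h1 h2
      by_contra! h
      exact hkmin m ⟨h1, lt_of_le_of_ne h.1 fun e => h1.ne (x.injective e), h.2⟩ h2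
    set t := Equiv.swap j k with ht
    have hlen : permLength (x * t) = permLength x + 1 := by
      rw [permLength_mul_swap x hjk hxk, Finset.card_eq_zero.2]
      refine Finset.filter_eq_empty_iff.2 fun m _ hm => ?_
      rcases hgap m hm.1 hm.2.1 with h | h <;> omega
    have hstep : BruhatStep x (x * t) := by
      refine ⟨x j, x k, fun e => hjk.ne (x.injective e), ?_, hlen⟩
      rw [Equiv.mul_swap_eq_swap_mul]
    have hbd := permLength_le (x * t)
    refine Relation.ReflTransGen.head hstep (ih (x * t) (by omega) fun p q => ?_)
    have hother : ∀ a, a ≠ j → a ≠ k → (x * t) a = x a := fun a h1 h2 => by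
      simp [ht, Equiv.swap_apply_of_ne_of_ne h1 h2]
    have hxtj : (x * t) j = x k := by simp [ht]
    rcases lt_or_ge p j with hpj | hpj
    · refine le_of_eq_of_le ?_ (hd p q)
      congr 1
      refine Finset.filter_congr fun a _ => and_congr_right fun ha => ?_
      rw [hother a (by omega) (by omega)]
    rcases lt_or_ge p k with hpk | hpk
    -- Only for `j ≤ p < k` and `x j < q ≤ x k` does the count grow. There, apart from `j`, the
    -- counted values either exceed `y j`, where domination at level `y j + 1` applies, or lie
    -- before `j`, where `x` and `y` agree.
    · by_cases hq : (x j : ℕ) < q ∧ q ≤ x k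
      · have h1 : (Finset.univ.filter fun a => a ≤ p ∧ q ≤ ((x * t) a : ℕ)) ⊆
            insert j ((Finset.univ.filter fun a => a ≤ p ∧ (y j : ℕ) + 1 ≤ x a) ∪
              (Finset.univ.filter fun a => a < j ∧ q ≤ y a ∧ y a ≤ y j)) := by
          intro a ha
          simp only [Finset.mem_filter, Finset.mem_univ, true_and, Finset.mem_insert,
            Finset.mem_union] at ha ⊢
          rcases eq_or_ne a j with rfl | haj
          · exact Or.inl rfl
          rw [hother a haj (by omega)] at ha
          by_cases hya : (y j : ℕ) + 1 ≤ x a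
          · exact Or.inr (Or.inl ⟨ha.1, hya⟩)
          · rcases lt_or_gt_of_ne haj with h | h
            · rw [← hbelow a h]
              exact Or.inr (Or.inr ⟨h, ha.2, by omega⟩)
            · rcases hgap a h (by omega) with h' | h' <;> omega
        have h2 : insert j ((Finset.univ.filter fun a => a ≤ p ∧ (y j : ℕ) + 1 ≤ y a) ∪
              (Finset.univ.filter fun a => a < j ∧ q ≤ y a ∧ y a ≤ y j)) ⊆
            (Finset.univ.filter fun a => a ≤ p ∧ q ≤ (y a : ℕ)) := by
          intro a ha
          simp only [Finset.mem_filter, Finset.mem_univ, true_and, Finset.mem_insert,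
            Finset.mem_union] at ha ⊢
          rcases ha with rfl | ha | ha <;> omega
        refine (Finset.card_le_card h1).trans (le_trans ?_ (Finset.card_le_card h2))
        have h3 := hd p (y j + 1)
        refine (Finset.card_insert_le _ _).trans ?_
        rw [Finset.card_insert_of_notMem, Finset.card_union_of_disjoint (s :=
          (Finset.univ.filter fun a => a ≤ p ∧ (y j : ℕ) + 1 ≤ y a))]
        · have := Finset.card_union_le
            (Finset.univ.filter fun a => a ≤ p ∧ (y j : ℕ) + 1 ≤ x a)
            (Finset.univ.filter fun a => a < j ∧ q ≤ y a ∧ y a ≤ y j)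
          omega
        · refine Finset.disjoint_filter.2 fun a _ h h' => ?_
          omega
        · simp
      · refine le_of_eq_of_le ?_ (hd p q)
        congr 1
        refine Finset.filter_congr fun a _ => and_congr_right fun ha => ?_
        rcases eq_or_ne a j with rfl | haj
        · rw [hxtj]; omega
        · rw [hother a haj (by omega)]
    · refine le_of_eq_of_le ?_ (hd p q)
      refine Finset.card_bij (fun a _ => t a) ?_ (fun a _ b _ h => t.injective h) ?_
      · intro a ha
        simp only [Finset.mem_filter, Finset.mem_univ, true_and] at ha ⊢
        refine ⟨?_, ha.2⟩
        rcases eq_or_ne a j with rfl | haj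
        · simpa [ht] using hpk
        · rcases eq_or_ne a k with rfl | hak
          · simpa [ht] using hpj
          · simpa [ht, Equiv.swap_apply_of_ne_of_ne haj hak] using ha.1
      · intro b hb
        simp only [Finset.mem_filter, Finset.mem_univ, true_and] at hb
        refine ⟨t b, ?_, by simp [ht]⟩
        simp only [Finset.mem_filter, Finset.mem_univ, true_and]
        refine ⟨?_, by simpa [ht] using hb.2⟩
        rcases eq_or_ne b j with rfl | haj
        · simpa [ht] using hpk
        · rcases eq_or_ne b k with rfl | hak
          · simpa [ht] using hpj
          · simpa [ht, Equiv.swap_apply_of_ne_of_ne haj hak] using hb.1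

end Combinatorics

/-! ### Pivots of a matrix and opposite Bruhat cells -/

section Pivots

open Matrix

/-- `M` can be brought by an invertible upper triangular row operation to a matrix whose `i`-th row
is nonzero at `w i` and vanishes at all columns of weight larger than that of `w i`. -/
def HasPivots {n : ℕ} (μ : Fin n → ℝ) (M : Matrix (Fin n) (Fin n) ℝ) (w : Equiv.Perm (Fin n)) :
    Prop :=
  ∃ V : Matrix (Fin n) (Fin n) ℝ, V.BlockTriangular id ∧ IsUnit V.det ∧
    ∀ i, (V * M) i (w i) ≠ 0 ∧ ∀ j, μ (w i) < μ j → (V * M) i j = 0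

lemma Matrix.BlockTriangular.inv_of_isUnit_det {n : ℕ} {α : Type*} [LinearOrder α]
    {b : Fin n → α} {V : Matrix (Fin n) (Fin n) ℝ} (hV : V.BlockTriangular b)
    (h : IsUnit V.det) : V⁻¹.BlockTriangular b := by
  have := Matrix.invertibleOfIsUnitDet V h
  exact blockTriangular_inv_of_blockTriangular hV

lemma Matrix.isUnit_det_inv {n : ℕ} {V : Matrix (Fin n) (Fin n) ℝ} (h : IsUnit V.det) :
    IsUnit V⁻¹.det :=
  Matrix.isUnit_nonsing_inv_det V h

lemma Matrix.BlockTriangular.diag_ne_zero {n : ℕ} {V : Matrix (Fin n) (Fin n) ℝ}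
    (hV : V.BlockTriangular id) (h : IsUnit V.det) (i : Fin n) : V i i ≠ 0 := by
  rw [det_of_isUpperTriangular hV, isUnit_iff_ne_zero, Finset.prod_ne_zero_iff] at h
  exact h i (Finset.mem_univ i)

lemma Matrix.BlockTriangular.isUnit_det {n : ℕ} {V : Matrix (Fin n) (Fin n) ℝ}
    (hV : V.BlockTriangular id) (h : ∀ i, V i i ≠ 0) : IsUnit V.det := by
  rw [det_of_isUpperTriangular hV, isUnit_iff_ne_zero, Finset.prod_ne_zero_iff]
  exact fun i _ => h i

lemma exists_leading_index {n : ℕ} (μ v : Fin n → ℝ) (hv : v ≠ 0) :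
    ∃ j, v j ≠ 0 ∧ ∀ j', μ j < μ j' → v j' = 0 := by
  obtain ⟨j₀, hj₀⟩ := Function.ne_iff.1 hv
  obtain ⟨j, hj, hmax⟩ := Finset.exists_max_image (Finset.univ.filter fun j => v j ≠ 0) μ
    ⟨j₀, by simpa using hj₀⟩
  refine ⟨j, by simpa using hj, fun j' hj' => ?_⟩
  by_contra h
  exact (hmax j' (by simpa using h)).not_gt hj'

/-- For each row take, among its combinations with later rows (its own coefficient being 1), one
whose leading index has least weight. If two rows had the same leading index, subtracting a multiple
of the later from the earlier would lower the weight further. -/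
lemma exists_hasPivots {n : ℕ} {μ : Fin n → ℝ} (hμ : Function.Injective μ)
    {M : Matrix (Fin n) (Fin n) ℝ} (hM : IsUnit M.det) : ∃ w, HasPivots μ M w := by
  classical
  let P : Fin n → Fin n → Prop := fun i j => ∃ c : Fin n → ℝ, c i = 1 ∧ (∀ k < i, c k = 0) ∧
    (c ᵥ* M) j ≠ 0 ∧ ∀ j', μ j < μ j' → (c ᵥ* M) j' = 0
  have hP : ∀ (i : Fin n) (c : Fin n → ℝ), c i = 1 → (∀ k < i, c k = 0) →
      ∃ j, (c ᵥ* M) j ≠ 0 ∧ ∀ j', μ j < μ j' → (c ᵥ* M) j' = 0 := by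
    intro i c hi _
    refine exists_leading_index μ _ fun h => ?_
    have := Matrix.eq_zero_of_vecMul_eq_zero hM.ne_zero h
    simp [this] at hi
  have hmin : ∀ i, ∃ j, P i j ∧ ∀ j', P i j' → μ j ≤ μ j' := by
    intro i
    obtain ⟨j₀, hj₀⟩ := hP i (Pi.single i 1) (by simp) (fun k hk => by simp [hk.ne])
    obtain ⟨j, hj, hm⟩ := Finset.exists_min_image (Finset.univ.filter fun j => P i j) μ
      ⟨j₀, by simpa using ⟨_, by simp, fun k hk => by simp [hk.ne], hj₀⟩⟩
    exact ⟨j, by simpa using hj, fun j' hj' => hm j' (by simpa using hj')⟩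
  choose w hw hwmin using hmin
  choose c hc1 hc0 hcw hcl using hw
  have hne : ∀ i i', i < i' → w i ≠ w i' := by
    intro i i' hlt he
    set r := (c i ᵥ* M) (w i) / (c i' ᵥ* M) (w i)
    have hd1 : (c i - r • c i') i = 1 := by simp [hc1, hc0 i' i hlt]
    have hd0 : ∀ k < i, (c i - r • c i') k = 0 := fun k hk => by
      simp [hc0 i k hk, hc0 i' k (hk.trans hlt)]
    have hval : ∀ j, ((c i - r • c i') ᵥ* M) j = (c i ᵥ* M) j - r * (c i' ᵥ* M) j := fun j => by
      simp [Matrix.sub_vecMul, Matrix.smul_vecMul]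
    obtain ⟨j, hj, hjl⟩ := hP i _ hd1 hd0
    have hle := hwmin i j ⟨_, hd1, hd0, hj, hjl⟩
    rcases hle.lt_or_eq with h | h
    · apply hj
      rw [hval, hcl i j h, hcl i' j (he ▸ h)]
      simp
    · apply hj
      rw [← hμ h, hval]
      have := hcw i'
      rw [← he] at this
      simp [r, div_mul_cancel₀ _ this]
  have hinj : Function.Injective w := by
    intro i i' h
    by_contra hii
    rcases lt_or_gt_of_ne hii with h' | h'
    · exact hne _ _ h' h
    · exact hne _ _ h' h.symm
  have htri : (Matrix.of c).BlockTriangular id := fun i j hij => hc0 i j hij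
  refine ⟨Equiv.ofBijective w (Finite.injective_iff_bijective.1 hinj), Matrix.of c, htri,
    htri.isUnit_det fun i => ?_, fun i => ⟨hcw i, fun j => hcl i j⟩⟩
  simp [hc1]

lemma HasPivots.mul_left {n : ℕ} {μ : Fin n → ℝ} {M U : Matrix (Fin n) (Fin n) ℝ}
    {w : Equiv.Perm (Fin n)} (h : HasPivots μ M w) (hU : U.BlockTriangular id)
    (hd : IsUnit U.det) : HasPivots μ (U * M) w := by
  obtain ⟨V, hV, hVd, hw⟩ := h
  refine ⟨V * U⁻¹, hV.mul (hU.inv_of_isUnit_det hd), ?_, ?_⟩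
  · rw [det_mul]
    exact hVd.mul (Matrix.isUnit_det_inv hd)
  · rw [Matrix.mul_assoc, ← Matrix.mul_assoc U⁻¹, Matrix.nonsing_inv_mul _ hd, Matrix.one_mul]
    exact hw

lemma HasPivots.submatrix {n : ℕ} {μ : Fin n → ℝ} {M : Matrix (Fin n) (Fin n) ℝ}
    {w : Equiv.Perm (Fin n)} (σ : Equiv.Perm (Fin n)) (h : HasPivots (μ ∘ σ) M w) :
    HasPivots μ (M.submatrix id σ.symm) (σ * w) := by
  obtain ⟨V, hV, hVd, hw⟩ := h
  have he : ∀ i j, (V * M.submatrix id σ.symm) i j = (V * M) i (σ.symm j) := fun i j => rfl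
  refine ⟨V, hV, hVd, fun i => ⟨?_, fun j hj => ?_⟩⟩
  · rw [he]
    simpa using (hw i).1
  · rw [he]
    exact (hw i).2 _ (by simpa using hj)

/-- Column `j` of `M * C` combines only the columns `k ≥ j` of `M`, so the last nonzero column of
each reduced row is preserved. -/
lemma HasPivots.mul_right {n : ℕ} {μ : Fin n → ℝ} (hμ : StrictMono μ)
    {M C : Matrix (Fin n) (Fin n) ℝ} {w : Equiv.Perm (Fin n)} (h : HasPivots μ M w)
    (hC : C.BlockTriangular OrderDual.toDual) (hd : IsUnit C.det) : HasPivots μ (M * C) w := by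
  obtain ⟨V, hV, hVd, hw⟩ := h
  have hdiag : ∀ j, C j j ≠ 0 := fun j => by
    rw [det_of_isLowerTriangular C hC, isUnit_iff_ne_zero, Finset.prod_ne_zero_iff] at hd
    exact hd j (Finset.mem_univ j)
  refine ⟨V, hV, hVd, fun i => ⟨?_, fun j hj => ?_⟩⟩
  · rw [← Matrix.mul_assoc, Matrix.mul_apply, Finset.sum_eq_single (w i)]
    · exact mul_ne_zero (hw i).1 (hdiag _)
    · intro k _ hk
      rcases lt_or_gt_of_ne hk with h | h
      · rw [hC (show OrderDual.toDual (w i) < OrderDual.toDual k from h), mul_zero]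
      · rw [(hw i).2 k (hμ h), zero_mul]
    · simp
  · rw [← Matrix.mul_assoc, Matrix.mul_apply]
    refine Finset.sum_eq_zero fun k _ => ?_
    rcases lt_or_ge (w i) k with h | h
    · rw [(hw i).2 k (hμ h), zero_mul]
    · have hkj : k < j := h.trans_lt (hμ.lt_iff_lt.1 hj)
      rw [hC (show OrderDual.toDual j < OrderDual.toDual k from hkj), mul_zero]

lemma eq_one_of_le_apply {n : ℕ} {w : Equiv.Perm (Fin n)} (h : ∀ i, i ≤ w i) : w = 1 := by
  have hs : ∑ i : Fin n, (i : ℕ) = ∑ i, (w i : ℕ) := (Equiv.sum_comp w fun i : Fin n => (i : ℕ)).symm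
  have := (Finset.sum_eq_sum_iff_of_le (s := Finset.univ) (f := fun i : Fin n => (i : ℕ))
    (g := fun i => (w i : ℕ)) fun i _ => h i).1 hs
  exact Equiv.ext fun i => Fin.ext (this i (Finset.mem_univ i)).symm

/-- After a generic elementary row operation below the diagonal an upper triangular matrix still
factors as an upper times a lower triangular matrix. -/
lemma exists_lower_mul_eq_transvection_mul_upper {n : ℕ} {T : Matrix (Fin n) (Fin n) ℝ}
    (hT : T.BlockTriangular id) (hd : IsUnit T.det) {a b : Fin n} (hab : a < b) :
    ∃ (ε : ℝ) (C T' : Matrix (Fin n) (Fin n) ℝ), ε ≠ 0 ∧ C.BlockTriangular OrderDual.toDual ∧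
      IsUnit C.det ∧ T'.BlockTriangular id ∧ IsUnit T'.det ∧
      T * C = Matrix.transvection b a ε * T' := by
  -- The finitely many excluded values are `0` and those making some factor `1 + ε κ` in `hgen`
  -- vanish.
  obtain ⟨ε, hε⟩ := Set.Finite.exists_notMem (s := insert (0 : ℝ) (Set.range fun i : Fin n =>
    -(∑ j, if j < i then T a j * T⁻¹ j b else 0)⁻¹)) ((Set.finite_range _).insert _)
  rw [Set.mem_insert_iff, not_or] at hε
  have hgen : ∀ i, 1 + ε * (∑ j, if j < i then T a j * T⁻¹ j b else 0) ≠ 0 := by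
    intro i h
    refine hε.2 ⟨i, ?_⟩
    set κ := ∑ j, if j < i then T a j * T⁻¹ j b else 0
    have hκ : κ ≠ 0 := fun h0 => by simp [h0] at h
    change -κ⁻¹ = ε
    field_simp
    linarith
  set N := Matrix.transvection b a (-ε) * T with hN
  have hNd : IsUnit N.det := by
    rw [hN, det_mul, det_transvection_of_ne _ _ hab.ne', one_mul]
    exact hd
  have hinj : Function.Injective (fun i : Fin n => (i : ℝ)) := fun i j h => by
    simpa [Fin.ext_iff] using h
  obtain ⟨w, V, hV, hVd, hw⟩ := exists_hasPivots hinj hNd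
  -- If `w i < i`, row `i` of `V * N` lives in columns before `i` and equals `-ε V i b` times row
  -- `a` of `T` there. Multiplying by column `b` of `T⁻¹` gives `V i b * (1 + ε κ) = 0`, so the row
  -- is zero.
  have hw1 : w = 1 := by
    refine eq_one_of_le_apply fun i => ?_
    by_contra hlt
    rw [not_le] at hlt
    have hdeq : ∀ j, (V * N) i j = ∑ m, V i m * T m j - ε * V i b * T a j := by
      intro j
      rw [hN, Matrix.transvection, Matrix.add_mul, Matrix.one_mul, Matrix.mul_add,
        Matrix.add_apply, Matrix.mul_apply, Matrix.mul_apply]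
      rw [sub_eq_add_neg]
      congr 1
      rw [Finset.sum_eq_single b]
      · simp
        ring
      · intro m _ hm
        rw [Matrix.single_mul_apply_of_ne _ _ _ _ _ hm, mul_zero]
      · simp
    have hsmall : ∀ j < i, (V * N) i j = -ε * V i b * T a j := by
      intro j hj
      rw [hdeq, Finset.sum_eq_zero]
      · ring
      · intro m _
        rcases lt_or_ge m i with h | h
        · rw [hV (show id m < id i from h), zero_mul]
        · rw [hT (show id j < id m from hj.trans_le h), mul_zero]
    have hbig : ∀ j, i ≤ j → (V * N) i j = 0 := fun j hj =>
      (hw i).2 j (by simpa using hlt.trans_le hj)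
    have hVb : V i b = 0 := by
      have h1 : ∑ j, (V * N) i j * T⁻¹ j b = V i b := by
        rw [← Matrix.mul_apply, hN, Matrix.mul_assoc, Matrix.mul_assoc,
          Matrix.mul_nonsing_inv _ hd, Matrix.mul_one, Matrix.transvection, Matrix.mul_add,
          Matrix.mul_one, Matrix.add_apply, Matrix.mul_single_apply_of_ne _ _ _ _ _ hab.ne',
          add_zero]
      have h2 : ∑ j, (V * N) i j * T⁻¹ j b =
          -ε * V i b * ∑ j, if j < i then T a j * T⁻¹ j b else 0 := by
        rw [Finset.mul_sum]
        refine Finset.sum_congr rfl fun j _ => ?_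
        split_ifs with h
        · rw [hsmall j h]; ring
        · rw [hbig j (not_lt.1 h)]; ring
      have h3 := hgen i
      have h4 : V i b * (1 + ε * ∑ j, if j < i then T a j * T⁻¹ j b else 0) = 0 := by
        linear_combination -h1 + h2
      exact (mul_eq_zero.1 h4).resolve_right h3
    apply (hw i).1
    rw [hsmall _ hlt, hVb]
    ring
  subst hw1
  have hX : (V * N).BlockTriangular OrderDual.toDual := fun i j hij =>
    (hw i).2 j (by simpa using hij)
  have hXd : IsUnit (V * N).det := by
    rw [det_mul]
    exact hVd.mul hNd
  refine ⟨ε, (V * N)⁻¹, V⁻¹, hε.1, hX.inv_of_isUnit_det hXd, Matrix.isUnit_det_inv hXd,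
    hV.inv_of_isUnit_det hVd, Matrix.isUnit_det_inv hVd, ?_⟩
  have hT' : T = Matrix.transvection b a ε * N := by
    rw [hN, ← Matrix.mul_assoc, Matrix.transvection_mul_transvection_same _ _ hab.ne']
    simp
  rw [Matrix.mul_inv_rev, ← Matrix.mul_assoc]
  nth_rewrite 1 [hT']
  rw [Matrix.mul_assoc (Matrix.transvection b a ε), Matrix.mul_nonsing_inv _ hNd, Matrix.mul_one]

/-- A Bruhat step upwards can be realised on the side of the lowest weights without changing the
pivots on the side of the highest weights. -/
lemma exists_hasPivots_of_bruhatStep {n : ℕ} {μ : Fin n → ℝ} (hμ : StrictMono μ)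
    {x y z : Equiv.Perm (Fin n)} (hyz : BruhatStep y z) {M : Matrix (Fin n) (Fin n) ℝ}
    (hM : IsUnit M.det) (hx : HasPivots μ M x) (hy : HasPivots (-μ) M y) :
    ∃ M' : Matrix (Fin n) (Fin n) ℝ, IsUnit M'.det ∧ HasPivots μ M' x ∧ HasPivots (-μ) M' z := by
  obtain ⟨a, b, hab, rfl, hlen⟩ := hyz
  wlog hlt : a < b generalizing a b
  · rw [Equiv.swap_comm] at hlen ⊢
    exact this b a hab.symm hlen (lt_of_le_of_ne (not_lt.1 hlt) hab.symm)
  have hpos := symm_apply_lt_of_permLength_lt (x := y) hlt (by omega)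
  obtain ⟨U, hU, hUd, hw⟩ := hy
  -- Ordering the reduced rows by their pivots makes the matrix upper triangular, as pivots for `-μ`
  -- are first nonzero columns.
  set T := (U * M).submatrix y.symm id with hTdef
  have hT : T.BlockTriangular id := fun i j hij => by
    have := (hw (y.symm i)).2 j (by simpa using hμ hij)
    simpa [hTdef] using this
  have hTd : IsUnit T.det := hT.isUnit_det fun i => by
    have := (hw (y.symm i)).1
    rw [Equiv.apply_symm_apply] at this
    simpa [hTdef] using this
  obtain ⟨ε, C, T', hε, hC, hCd, hT', hTd', hTC⟩ :=
    exists_lower_mul_eq_transvection_mul_upper hT hTd hlt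
  have hrow : ∀ i j, (U * (M * C)) i j = T' (y i) j + if y i = b then ε * T' a j else 0 := by
    intro i j
    have h1 : (U * (M * C)) i j = (T * C) (y i) j := by
      rw [← Matrix.mul_assoc, Matrix.mul_apply, Matrix.mul_apply]
      simp [hTdef]
    rw [h1, hTC, Matrix.transvection, Matrix.add_mul, Matrix.one_mul, Matrix.add_apply]
    congr 1
    split_ifs with h
    · rw [h]; simp
    · rw [Matrix.single_mul_apply_of_ne _ _ _ _ _ h]
  -- After multiplication by `C`, the rows that had pivots `a` and `b` are `T' a` and `T' b + ε T'
  -- a`. Subtracting `ε⁻¹` times the second from the first leaves `-ε⁻¹ T' b`: the pivots are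
  -- exchanged. This operation is upper triangular precisely because the step raises the length.
  have hTV : (Matrix.transvection (y.symm a) (y.symm b) (-ε⁻¹)).BlockTriangular id := by
    exact Matrix.blockTriangular_transvection (b := (id : Fin n → Fin n)) hpos.le _
  refine ⟨M * C, ?_, hx.mul_right hμ hC hCd,
    Matrix.transvection (y.symm a) (y.symm b) (-ε⁻¹) * U, hTV.mul hU, ?_, fun i => ?_⟩
  · rw [det_mul]
    exact hM.mul hCd
  · rw [det_mul, det_transvection_of_ne _ _ hpos.ne, one_mul]
    exact hUd
  have hrow' : ∀ j, (Matrix.transvection (y.symm a) (y.symm b) (-ε⁻¹) * U * (M * C)) i j =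
      if y i = a then -ε⁻¹ * T' b j else if y i = b then T' b j + ε * T' a j else T' (y i) j := by
    intro j
    rw [Matrix.mul_assoc, Matrix.transvection, Matrix.add_mul, Matrix.one_mul, Matrix.add_apply,
      hrow]
    by_cases h : y i = a
    · have hi : i = y.symm a := by rw [← h, Equiv.symm_apply_apply]
      rw [if_pos h, hi, Matrix.single_mul_apply_same, hrow]
      simp only [Equiv.apply_symm_apply, hlt.ne, if_true, if_false]
      field_simp
      ring
    · have hi : i ≠ y.symm a := fun e => h (by rw [e, Equiv.apply_symm_apply])
      rw [if_neg h, Matrix.single_mul_apply_of_ne _ _ _ _ _ hi, add_zero]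
      split_ifs with h'
      · rw [h']
      · rw [add_zero]
  have hdiag := fun i => hT'.diag_ne_zero hTd' i
  have hz : (Equiv.swap a b * y) i = if y i = a then b else if y i = b then a else y i := by
    rw [Equiv.Perm.mul_apply, Equiv.swap_apply_def]
  simp only [hrow', hz]
  have hneg : ∀ i j, (-μ) i < (-μ) j → j < i := fun i j h => by
    simpa [hμ.lt_iff_lt] using h
  split_ifs with h1 h2
  · exact ⟨mul_ne_zero (neg_ne_zero.2 (inv_ne_zero hε)) (hdiag b), fun j hj => by
      rw [hT' (show id j < id b from hneg _ _ hj), mul_zero]⟩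
  · refine ⟨?_, fun j hj => ?_⟩
    · rw [hT' (show id a < id b from hlt), zero_add]
      exact mul_ne_zero hε (hdiag a)
    · have hja := hneg _ _ hj
      rw [hT' (show id j < id b from hja.trans hlt), hT' (show id j < id a from hja)]
      simp
  · exact ⟨hdiag _, fun j hj => hT' (show id j < id (y i) from hneg _ _ hj)⟩

lemma exists_hasPivots_of_bruhatLE {n : ℕ} {μ : Fin n → ℝ} (hμ : StrictMono μ)
    {x y : Equiv.Perm (Fin n)} (hxy : BruhatLE x y) :
    ∃ M : Matrix (Fin n) (Fin n) ℝ, IsUnit M.det ∧ HasPivots μ M x ∧ HasPivots (-μ) M y := by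
  induction hxy with
  | refl =>
    have h : ∀ ν : Fin n → ℝ, HasPivots ν ((1 : Matrix (Fin n) (Fin n) ℝ).submatrix x id) x := by
      refine fun ν => ⟨1, blockTriangular_one, by simp, fun i => ⟨by simp [Matrix.one_apply], fun j hj => ?_⟩⟩
      have : x i ≠ j := fun e => by simp [e] at hj
      simp [this]
    refine ⟨_, ?_, h μ, h (-μ)⟩
    rw [Matrix.det_permute]
    simp
  | tail _ hstep ih =>
    obtain ⟨M, hM, h1, h2⟩ := ih
    exact exists_hasPivots_of_bruhatStep hμ hstep hM h1 h2

/-- The chosen rows of `U * M` vanish at weights below `s`, those of `V * M` at weights at least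
`s`, so their spans are independent. Both lie in the span of the rows of `M` after `p`, which bounds
the sum of the dimensions. -/
lemma card_add_card_le_of_hasPivots {n : ℕ} {μ : Fin n → ℝ} {u v : Equiv.Perm (Fin n)}
    {M : Matrix (Fin n) (Fin n) ℝ} (hM : IsUnit M.det) (hv : HasPivots μ M v)
    (hu : HasPivots (-μ) M u) (p : Fin n) (s : ℝ) :
    Fintype.card {i // p < i ∧ s ≤ μ (u i)} + Fintype.card {i // p < i ∧ μ (v i) < s} ≤
      Fintype.card {i // p < i} := by
  obtain ⟨V, hV, hVd, hv⟩ := hv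
  obtain ⟨U, hU, hUd, hu⟩ := hu
  let A := {i // p < i ∧ s ≤ μ (u i)}
  let B := {i // p < i ∧ μ (v i) < s}
  let EA := Function.ExtendByZero.linearMap ℝ (Subtype.val : A → Fin n)
  let EB := Function.ExtendByZero.linearMap ℝ (Subtype.val : B → Fin n)
  have hEA : ∀ (f : A → ℝ) i, ¬ (p < i ∧ s ≤ μ (u i)) → EA f i = 0 := fun f i hi =>
    Function.extend_apply' _ _ _ (by rintro ⟨a, rfl⟩; exact hi a.2)
  have hEB : ∀ (f : B → ℝ) i, ¬ (p < i ∧ μ (v i) < s) → EB f i = 0 := fun f i hi =>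
    Function.extend_apply' _ _ _ (by rintro ⟨a, rfl⟩; exact hi a.2)
  let F : (A → ℝ) × (B → ℝ) →ₗ[ℝ] (Fin n → ℝ) :=
    U.vecMulLinear ∘ₗ EA ∘ₗ LinearMap.fst ℝ _ _ + V.vecMulLinear ∘ₗ EB ∘ₗ LinearMap.snd ℝ _ _
  let R : (Fin n → ℝ) →ₗ[ℝ] ({i // p < i} → ℝ) := LinearMap.funLeft ℝ ℝ Subtype.val
  have hinj : Function.Injective (R ∘ₗ F) := by
    rw [← LinearMap.ker_eq_bot, LinearMap.ker_eq_bot']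
    rintro ⟨f, g⟩ h0
    have hF : EA f ᵥ* U + EB g ᵥ* V = 0 := by
      funext k
      rcases lt_or_ge p k with hk | hk
      · exact congrFun h0 ⟨k, hk⟩
      · have h1 : (EA f ᵥ* U) k = 0 := by
          change ∑ i, EA f i * U i k = 0
          refine Finset.sum_eq_zero fun i _ => ?_
          rcases lt_or_ge p i with hi | hi
          · rw [hU (show id k < id i from hk.trans_lt hi), mul_zero]
          · rw [hEA f i fun h => hi.not_gt h.1, zero_mul]
        have h2 : (EB g ᵥ* V) k = 0 := by
          change ∑ i, EB g i * V i k = 0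
          refine Finset.sum_eq_zero fun i _ => ?_
          rcases lt_or_ge p i with hi | hi
          · rw [hV (show id k < id i from hk.trans_lt hi), mul_zero]
          · rw [hEB g i fun h => hi.not_gt h.1, zero_mul]
        rw [Pi.add_apply, h1, h2]
        simp
    have hFM : EA f ᵥ* (U * M) + EB g ᵥ* (V * M) = 0 := by
      rw [← Matrix.vecMul_vecMul, ← Matrix.vecMul_vecMul, ← Matrix.add_vecMul, hF,
        Matrix.zero_vecMul]
    have hA : ∀ j, μ j < s → (EA f ᵥ* (U * M)) j = 0 := fun j hj => by
      change ∑ i, EA f i * (U * M) i j = 0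
      refine Finset.sum_eq_zero fun i _ => ?_
      by_cases hi : p < i ∧ s ≤ μ (u i)
      · rw [(hu i).2 j (by simpa using hj.trans_le hi.2), mul_zero]
      · rw [hEA f i hi, zero_mul]
    have hB : ∀ j, s ≤ μ j → (EB g ᵥ* (V * M)) j = 0 := fun j hj => by
      change ∑ i, EB g i * (V * M) i j = 0
      refine Finset.sum_eq_zero fun i _ => ?_
      by_cases hi : p < i ∧ μ (v i) < s
      · rw [(hv i).2 j (hi.2.trans_le hj), mul_zero]
      · rw [hEB g i hi, zero_mul]
    have hA' : EA f ᵥ* (U * M) = 0 := by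
      funext j
      rcases lt_or_ge (μ j) s with hj | hj
      · exact hA j hj
      · have := congrFun hFM j
        rw [Pi.add_apply, hB j hj, add_zero] at this
        exact this
    have hB' : EB g ᵥ* (V * M) = 0 := by
      rw [hA', zero_add] at hFM
      exact hFM
    have hf : EA f = 0 := Matrix.eq_zero_of_vecMul_eq_zero
      (by rw [det_mul]; exact mul_ne_zero hUd.ne_zero hM.ne_zero) hA'
    have hg : EB g = 0 := Matrix.eq_zero_of_vecMul_eq_zero
      (by rw [det_mul]; exact mul_ne_zero hVd.ne_zero hM.ne_zero) hB'
    ext a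
    · have := congrFun hf a.1
      exact (Subtype.val_injective.extend_apply f 0 a).symm.trans this
    · have := congrFun hg a.1
      exact (Subtype.val_injective.extend_apply g 0 a).symm.trans this
  have := LinearMap.finrank_le_finrank_of_injective hinj
  rwa [Module.finrank_prod, Module.finrank_fintype_fun_eq_card,
    Module.finrank_fintype_fun_eq_card, Module.finrank_fintype_fun_eq_card] at this

/-- The pivots of a matrix on the two sides are comparable in the Bruhat order. -/
lemma bruhatLE_of_hasPivots {n : ℕ} {μ : Fin n → ℝ} {σ : Equiv.Perm (Fin n)}
    (hσ : StrictMono fun i => μ (σ i)) {u v : Equiv.Perm (Fin n)} {M : Matrix (Fin n) (Fin n) ℝ}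
    (hM : IsUnit M.det) (hv : HasPivots μ M v) (hu : HasPivots (-μ) M u) :
    BruhatLE (σ⁻¹ * v) (σ⁻¹ * u) := by
  refine bruhatLE_of_card_le _ _ fun p q => ?_
  by_cases hq : q < n
  swap
  · rw [Finset.card_eq_zero.2]
    · exact Nat.zero_le _
    · exact Finset.filter_eq_empty_iff.2 fun a _ h => by omega
  set s := μ (σ ⟨q, hq⟩)
  have hiff : ∀ (w : Equiv.Perm (Fin n)) a, q ≤ ((σ⁻¹ * w) a : ℕ) ↔ s ≤ μ (w a) := by
    intro w a
    have := hσ.le_iff_le (a := ⟨q, hq⟩) (b := (σ⁻¹ * w) a)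
    rw [show σ ((σ⁻¹ * w) a) = w a from σ.apply_symm_apply _, Fin.le_def] at this
    exact this.symm
  simp only [hiff]
  have h := card_add_card_le_of_hasPivots hM hv hu p s
  rw [Fintype.card_subtype, Fintype.card_subtype, Fintype.card_subtype] at h
  -- The total number of values of weight at least `s` is the same for `u` and `v`, so the
  -- inequality for positions after `p` turns into one for positions up to `p`.
  have hsplit : ∀ w : Equiv.Perm (Fin n),
      (Finset.univ.filter fun a => a ≤ p ∧ s ≤ μ (w a)).card +
      (Finset.univ.filter fun a => p < a ∧ s ≤ μ (w a)).card =
      (Finset.univ.filter fun a => s ≤ μ a).card := by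
    intro w
    have h1 : (Finset.univ.filter fun a => s ≤ μ (w a)).card =
        (Finset.univ.filter fun a => s ≤ μ a).card := by
      refine Finset.card_bij (fun a _ => w a) ?_ (fun a _ b _ h => w.injective h) ?_
      · intro a ha; simpa using ha
      · intro b hb
        exact ⟨w.symm b, by simpa using hb, by simp⟩
    rw [← h1, ← Finset.card_filter_add_card_filter_not (s := Finset.univ.filter fun a => s ≤ μ (w a))
      (fun a => a ≤ p), Finset.filter_filter, Finset.filter_filter]
    congr 2 <;> ext a <;> simp [and_comm]
  have hsplit' : (Finset.univ.filter fun a => p < a ∧ s ≤ μ (v a)).card +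
      (Finset.univ.filter fun a => p < a ∧ μ (v a) < s).card =
      (Finset.univ.filter fun a => p < a).card := by
    rw [← Finset.card_filter_add_card_filter_not (s := Finset.univ.filter fun a => p < a)
      (fun a => s ≤ μ (v a)), Finset.filter_filter, Finset.filter_filter]
    simp only [not_le]
  have hu' := hsplit u
  have hv' := hsplit v
  omega

end Pivots

/-! ### Orthogonal matrices, `RQ` decomposition and the flag manifold -/

section SpecialOrthogonal

open Matrix

lemma mem_specialOrthogonalGroup_of_mul_transpose {n : ℕ} {Q : Matrix (Fin n) (Fin n) ℝ}
    (h : Q * Qᵀ = 1) (hd : Q.det = 1) : Q ∈ Matrix.specialOrthogonalGroup (Fin n) ℝ :=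
  Matrix.mem_specialOrthogonalGroup_iff.2 ⟨(Matrix.mem_orthogonalGroup_iff _ _).2 h, hd⟩

namespace SO

lemma mul_transpose {n : ℕ} (Ψ : SO n) :
    (Ψ : Matrix (Fin n) (Fin n) ℝ) * (Ψ : Matrix (Fin n) (Fin n) ℝ)ᵀ = 1 :=
  (Matrix.mem_orthogonalGroup_iff _ _).1 (Matrix.mem_specialOrthogonalGroup_iff.1 Ψ.2).1

lemma transpose_mul {n : ℕ} (Ψ : SO n) :
    (Ψ : Matrix (Fin n) (Fin n) ℝ)ᵀ * (Ψ : Matrix (Fin n) (Fin n) ℝ) = 1 :=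
  mul_eq_one_comm.1 Ψ.mul_transpose

lemma det_eq_one {n : ℕ} (Ψ : SO n) : (Ψ : Matrix (Fin n) (Fin n) ℝ).det = 1 :=
  (Matrix.mem_specialOrthogonalGroup_iff.1 Ψ.2).2

lemma sum_mul {n : ℕ} (Ψ : SO n) (i k : Fin n) :
    ∑ j, (Ψ : Matrix (Fin n) (Fin n) ℝ) i j * (Ψ : Matrix (Fin n) (Fin n) ℝ) k j =
      if i = k then 1 else 0 := by
  have := congrFun (congrFun Ψ.mul_transpose i) k
  rwa [Matrix.mul_apply, Matrix.one_apply] at this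

lemma abs_apply_le_one {n : ℕ} (Ψ : SO n) (i j : Fin n) :
    |(Ψ : Matrix (Fin n) (Fin n) ℝ) i j| ≤ 1 := by
  have h := Ψ.sum_mul i i
  rw [if_pos rfl] at h
  have := Finset.single_le_sum (f := fun j => (Ψ : Matrix (Fin n) (Fin n) ℝ) i j *
    (Ψ : Matrix (Fin n) (Fin n) ℝ) i j) (fun _ _ => mul_self_nonneg _) (Finset.mem_univ j)
  rw [h] at this
  exact abs_le_one_iff_mul_self_le_one.2 this

lemma abs_apply_of_support {n : ℕ} (Ψ : SO n) {w : Equiv.Perm (Fin n)}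
    (h : ∀ i j, j ≠ w i → (Ψ : Matrix (Fin n) (Fin n) ℝ) i j = 0) (i j : Fin n) :
    |(Ψ : Matrix (Fin n) (Fin n) ℝ) i j| = if j = w i then 1 else 0 := by
  split_ifs with hj
  · have h1 := Ψ.sum_mul i i
    rw [if_pos rfl, Finset.sum_eq_single (w i) (fun k _ hk => by rw [h i k hk, zero_mul])
      (by simp)] at h1
    rw [hj, ← abs_one]
    exact abs_eq_abs.2 (mul_self_eq_one_iff.1 h1)
  · rw [h i j hj, abs_zero]

lemma apply_eq_zero_of_abs {n : ℕ} {Ψ : SO n} {w : Equiv.Perm (Fin n)}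
    (h : ∀ i j, |(Ψ : Matrix (Fin n) (Fin n) ℝ) i j| = if j = w i then 1 else 0) {i j : Fin n}
    (hj : j ≠ w i) : (Ψ : Matrix (Fin n) (Fin n) ℝ) i j = 0 := by
  have := h i j
  rwa [if_neg hj, abs_eq_zero] at this

end SO

/-- Flipping the sign of one row moves an orthogonal matrix into the special orthogonal group. -/
lemma exists_diagonal_mul_mem_specialOrthogonalGroup {n : ℕ} {Q : Matrix (Fin n) (Fin n) ℝ}
    (h : Q * Qᵀ = 1) : ∃ d : Fin n → ℝ, (∀ i, d i * d i = 1) ∧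
      Matrix.diagonal d * Q ∈ Matrix.specialOrthogonalGroup (Fin n) ℝ := by
  have hdet : Q.det * Q.det = 1 := by
    have := congrArg Matrix.det h
    rwa [det_mul, det_transpose, det_one] at this
  have key : ∀ d : Fin n → ℝ, (∀ i, d i * d i = 1) →
      (Matrix.diagonal d * Q) * (Matrix.diagonal d * Q)ᵀ = 1 := fun d hd => by
    rw [Matrix.transpose_mul, Matrix.diagonal_transpose, Matrix.mul_assoc, ← Matrix.mul_assoc Q,
      h, Matrix.one_mul, Matrix.diagonal_mul_diagonal]
    simp [hd]
  rcases mul_self_eq_one_iff.1 hdet with h1 | h1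
  · exact ⟨fun _ => 1, by simp, mem_specialOrthogonalGroup_of_mul_transpose (key _ (by simp))
      (by simp [h1])⟩
  · have hn : n ≠ 0 := by
      rintro rfl
      rw [Matrix.det_isEmpty] at h1
      norm_num at h1
    have hd : ∀ i, Function.update (fun _ : Fin n => (1 : ℝ)) ⟨0, Nat.pos_of_ne_zero hn⟩ (-1) i *
        Function.update (fun _ : Fin n => (1 : ℝ)) ⟨0, Nat.pos_of_ne_zero hn⟩ (-1) i = 1 := by
      intro i
      rw [Function.update_apply]
      split_ifs <;> norm_num
    refine ⟨_, hd, mem_specialOrthogonalGroup_of_mul_transpose (key _ hd) ?_⟩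
    rw [det_mul, det_diagonal, h1, Finset.prod_update_of_mem (Finset.mem_univ _)]
    simp

/-- An `RQ` decomposition: every invertible matrix is special orthogonal up to an upper triangular
factor on the left. -/
lemma exists_upper_mul_mem_specialOrthogonalGroup {n : ℕ} {M : Matrix (Fin n) (Fin n) ℝ}
    (hM : IsUnit M.det) : ∃ U : Matrix (Fin n) (Fin n) ℝ, U.BlockTriangular id ∧ IsUnit U.det ∧
      U * M ∈ Matrix.specialOrthogonalGroup (Fin n) ℝ := by
  -- The index order is reversed so that the lower triangular factor of the `LDL` decomposition
  -- becomes upper triangular.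
  have hS : Matrix.PosDef (n := (Fin n)ᵒᵈ) (M * Mᵀ : Matrix (Fin n) (Fin n) ℝ) :=
    Matrix.PosDef.mul_conjTranspose_self M
      (Matrix.vecMul_injective_iff_isUnit.2 ((Matrix.isUnit_iff_isUnit_det M).2 hM))
  set K : Matrix (Fin n) (Fin n) ℝ := LDL.lowerInv (n := (Fin n)ᵒᵈ) hS with hK
  have hKtri : K.BlockTriangular id := fun i j hij =>
    LDL.lowerInv_triangular (n := (Fin n)ᵒᵈ) hS (i := OrderDual.toDual i) (j := OrderDual.toDual j) hij
  have hKd : IsUnit K.det := by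
    have : Invertible K := LDL.invertibleLowerInv (n := (Fin n)ᵒᵈ) hS
    exact Matrix.isUnit_det_of_invertible K
  set D : Fin n → ℝ := LDL.diagEntries (n := (Fin n)ᵒᵈ) hS
  have hdiag : Matrix.diagonal D = (K * M) * (K * M)ᵀ := by
    have h := LDL.diag_eq_lowerInv_conj (n := (Fin n)ᵒᵈ) hS
    rw [Matrix.transpose_mul, ← Matrix.mul_assoc, Matrix.mul_assoc K]
    exact h
  have hKM : IsUnit (K * M).det := by
    rw [det_mul]
    exact hKd.mul hM
  have hpos : ∀ i, 0 < D i := by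
    intro i
    have h1 : D i = ∑ j, (K * M) i j * (K * M) i j := by
      have := congrFun (congrFun hdiag i) i
      rw [Matrix.mul_apply] at this
      exact (Matrix.diagonal_apply_eq D i).symm.trans this
    have h2 : 0 ≤ D i := h1 ▸ Finset.sum_nonneg fun _ _ => mul_self_nonneg _
    refine lt_of_le_of_ne h2 fun h0 => ?_
    have h3 : (Matrix.diagonal D).det = (K * M).det * (K * M).det := by
      rw [hdiag, det_mul, Matrix.det_transpose]
    have h4 : (Matrix.diagonal D).det = 0 := by
      rw [det_diagonal]
      exact Finset.prod_eq_zero (Finset.mem_univ i) h0.symm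
    exact mul_ne_zero hKM.ne_zero hKM.ne_zero (h3.symm.trans h4)
  set E : Matrix (Fin n) (Fin n) ℝ := Matrix.diagonal fun i => (Real.sqrt (D i))⁻¹
  have hQ : (E * (K * M)) * (E * (K * M))ᵀ = 1 := by
    rw [Matrix.transpose_mul, Matrix.mul_assoc, ← Matrix.mul_assoc (K * M)]
    have : (K * M) * (K * M)ᵀ = Matrix.diagonal D := hdiag.symm
    rw [this, Matrix.diagonal_transpose, Matrix.diagonal_mul_diagonal,
      Matrix.diagonal_mul_diagonal, ← Matrix.diagonal_one]
    congr 1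
    funext i
    have := Real.sq_sqrt (hpos i).le
    have h0 := (Real.sqrt_pos.2 (hpos i)).ne'
    field_simp
    exact this.symm
  obtain ⟨d, hd, hmem⟩ := exists_diagonal_mul_mem_specialOrthogonalGroup hQ
  refine ⟨Matrix.diagonal d * (E * K), ?_, ?_, ?_⟩
  · exact (Matrix.blockTriangular_diagonal d).mul ((Matrix.blockTriangular_diagonal _).mul hKtri)
  · rw [det_mul, det_mul, det_diagonal, det_diagonal]
    refine IsUnit.mul ?_ (IsUnit.mul ?_ hKd)
    · exact isUnit_iff_ne_zero.2 (Finset.prod_ne_zero_iff.2 fun i _ h => by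
        have := hd i
        simp [h] at this)
    · exact isUnit_iff_ne_zero.2 (Finset.prod_ne_zero_iff.2 fun i _ =>
        inv_ne_zero (Real.sqrt_pos.2 (hpos i)).ne')
  · rwa [Matrix.mul_assoc, Matrix.mul_assoc]

lemma exists_signed_permutation {n : ℕ} (w : Equiv.Perm (Fin n)) :
    ∃ Ψ : SO n, ∀ i j, |(Ψ : Matrix (Fin n) (Fin n) ℝ) i j| = if j = w i then 1 else 0 := by
  have h : ((1 : Matrix (Fin n) (Fin n) ℝ).submatrix w id) *
      ((1 : Matrix (Fin n) (Fin n) ℝ).submatrix w id)ᵀ = 1 := by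
    rw [Matrix.transpose_submatrix, Matrix.transpose_one,
      Matrix.submatrix_mul _ _ w id w Function.bijective_id |>.symm, Matrix.mul_one,
      Matrix.submatrix_one_equiv]
  obtain ⟨d, _, hmem⟩ := exists_diagonal_mul_mem_specialOrthogonalGroup h
  refine ⟨⟨_, hmem⟩, SO.abs_apply_of_support _ fun i j hj => ?_⟩
  simp [Matrix.diagonal_mul, hj.symm]

lemma abs_apply_eq_of_mk_eq {n : ℕ} {Ψ Φ : SO n} (h : (Ψ : FlagManifold n) = (Φ : FlagManifold n))
    (i j : Fin n) : |(Ψ : Matrix (Fin n) (Fin n) ℝ) i j| = |(Φ : Matrix (Fin n) (Fin n) ℝ) i j| := by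
  rw [QuotientGroup.eq] at h
  set D := Ψ⁻¹ * Φ with hD
  have hdiag : (D : Matrix (Fin n) (Fin n) ℝ).IsDiag := h
  have hΦ : Φ = Ψ * D := by rw [hD, mul_inv_cancel_left]
  have hentry : (Φ : Matrix (Fin n) (Fin n) ℝ) i j =
      (Ψ : Matrix (Fin n) (Fin n) ℝ) i j * (D : Matrix (Fin n) (Fin n) ℝ) j j := by
    rw [hΦ]
    change ((Ψ : Matrix (Fin n) (Fin n) ℝ) * (D : Matrix (Fin n) (Fin n) ℝ)) i j = _
    rw [Matrix.mul_apply]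
    exact Finset.sum_eq_single j (fun k _ hk => by rw [hdiag hk, mul_zero]) (by simp)
  have hD1 := D.abs_apply_of_support (w := 1) (fun i j hij => hdiag (Ne.symm hij)) j j
  rw [hentry, abs_mul, hD1]
  simp

/-- Two signed permutation matrices with the same support differ by `Ψᵀ Φ`, which is diagonal. -/
lemma mk_eq_mk_of_abs_apply {n : ℕ} {Ψ Φ : SO n} {w : Equiv.Perm (Fin n)}
    (hΨ : ∀ i j, |(Ψ : Matrix (Fin n) (Fin n) ℝ) i j| = if j = w i then 1 else 0)
    (hΦ : ∀ i j, |(Φ : Matrix (Fin n) (Fin n) ℝ) i j| = if j = w i then 1 else 0) :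
    (Ψ : FlagManifold n) = (Φ : FlagManifold n) := by
  rw [QuotientGroup.eq]
  intro j k hjk
  change ((Ψ : Matrix (Fin n) (Fin n) ℝ)ᵀ * (Φ : Matrix (Fin n) (Fin n) ℝ)) j k = 0
  rw [Matrix.mul_apply]
  refine Finset.sum_eq_zero fun i _ => ?_
  by_cases hj : j = w i
  · rw [SO.apply_eq_zero_of_abs hΦ (fun hk => hjk (hj.trans hk.symm)), mul_zero]
  · rw [Matrix.transpose_apply, SO.apply_eq_zero_of_abs hΨ hj, zero_mul]

lemma mk_eq_iff_abs_apply {n : ℕ} {Ψ Φ : SO n} {w : Equiv.Perm (Fin n)}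
    (hΦ : ∀ i j, |(Φ : Matrix (Fin n) (Fin n) ℝ) i j| = if j = w i then 1 else 0) :
    (Ψ : FlagManifold n) = (Φ : FlagManifold n) ↔
      ∀ i j, |(Ψ : Matrix (Fin n) (Fin n) ℝ) i j| = if j = w i then 1 else 0 :=
  ⟨fun h i j => (abs_apply_eq_of_mk_eq h i j).trans (hΦ i j), fun h => mk_eq_mk_of_abs_apply h hΦ⟩

/-- The absolute value of a matrix entry as a function on the flag manifold. -/
def FlagManifold.absEntry {n : ℕ} (i j : Fin n) : FlagManifold n → ℝ :=
  Quotient.lift (fun Ψ : SO n => |(Ψ : Matrix (Fin n) (Fin n) ℝ) i j|)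
    fun _ _ h => abs_apply_eq_of_mk_eq (Quotient.sound h) i j

lemma FlagManifold.continuous_absEntry {n : ℕ} (i j : Fin n) :
    Continuous (FlagManifold.absEntry i j : FlagManifold n → ℝ) :=
  Continuous.quotient_lift
    ((continuous_subtype_val.matrix_elem i j).abs) _

/-! ### Singular points of the flow -/

lemma laxMatrix_apply {n : ℕ} (lam : Fin n → ℝ) (Ψ : SO n) (i k : Fin n) :
    laxMatrix lam Ψ i k = ∑ j, (Ψ : Matrix (Fin n) (Fin n) ℝ) i j * lam j *
      (Ψ : Matrix (Fin n) (Fin n) ℝ) k j := by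
  rw [laxMatrix, Matrix.mul_apply]
  simp [Matrix.mul_diagonal]

lemma laxMatrix_mul {n : ℕ} (lam : Fin n → ℝ) (Ψ : SO n) :
    laxMatrix lam Ψ * (Ψ : Matrix (Fin n) (Fin n) ℝ) =
      (Ψ : Matrix (Fin n) (Fin n) ℝ) * Matrix.diagonal lam := by
  rw [laxMatrix, Matrix.mul_assoc, Ψ.transpose_mul, Matrix.mul_one]

lemma mul_sub_eq_zero_of_laxMatrix_eq_diagonal {n : ℕ} {lam m : Fin n → ℝ} {Ψ : SO n}
    (h : laxMatrix lam Ψ = Matrix.diagonal m) (i j : Fin n) :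
    (Ψ : Matrix (Fin n) (Fin n) ℝ) i j * (lam j - m i) = 0 := by
  have h1 := congrFun (congrFun (laxMatrix_mul lam Ψ) i) j
  rw [h, Matrix.diagonal_mul, Matrix.mul_diagonal] at h1
  linear_combination -h1

/-- If `L` is diagonal, comparing entries in `L Ψ = Ψ Λ` kills `Ψ i j` unless `lam j` is the `i`-th
diagonal entry of `L`; distinct eigenvalues leave one entry per row. -/
lemma laxMatrix_eq_diagonal_iff {n : ℕ} {lam : Fin n → ℝ} (hlam : Function.Injective lam)
    {Ψ : SO n} {w : Equiv.Perm (Fin n)} :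
    laxMatrix lam Ψ = Matrix.diagonal (fun i => lam (w i)) ↔
      ∀ i j, |(Ψ : Matrix (Fin n) (Fin n) ℝ) i j| = if j = w i then 1 else 0 := by
  constructor
  · refine fun h => Ψ.abs_apply_of_support fun i j hj => ?_
    exact (mul_eq_zero.1 (mul_sub_eq_zero_of_laxMatrix_eq_diagonal h i j)).resolve_right
      (sub_ne_zero.2 fun e => hj (hlam e))
  · intro h
    ext i k
    have hz : ∀ i j, j ≠ w i → (Ψ : Matrix (Fin n) (Fin n) ℝ) i j = 0 := fun i j hj =>
      SO.apply_eq_zero_of_abs h hj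
    have h1 := Ψ.sum_mul i k
    have hs : ∀ f : Fin n → ℝ, (∀ j, j ≠ w i → f j = 0) → ∑ j, f j = f (w i) := fun f hf =>
      Finset.sum_eq_single (w i) (fun j _ hj => hf j hj) (by simp)
    rw [hs _ fun j hj => by rw [hz i j hj, zero_mul]] at h1
    rw [laxMatrix_apply, hs _ fun j hj => by rw [hz i j hj, zero_mul, zero_mul],
      Matrix.diagonal_apply, mul_right_comm, h1]
    split_ifs <;> simp

lemma exists_perm_of_laxMatrix_eq_diagonal {n : ℕ} {lam m : Fin n → ℝ}
    (hlam : Function.Injective lam) {Ψ : SO n} (h : laxMatrix lam Ψ = Matrix.diagonal m) :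
    ∃ w : Equiv.Perm (Fin n), laxMatrix lam Ψ = Matrix.diagonal (fun i => lam (w i)) := by
  have hex : ∀ i, ∃ j, (Ψ : Matrix (Fin n) (Fin n) ℝ) i j ≠ 0 := by
    intro i
    by_contra! h0
    have := Ψ.sum_mul i i
    simp [h0] at this
  choose w hw using hex
  have hm : ∀ i, m i = lam (w i) := fun i => by
    have := (mul_eq_zero.1 (mul_sub_eq_zero_of_laxMatrix_eq_diagonal h i (w i))).resolve_left (hw i)
    linarith
  have hz : ∀ i j, j ≠ w i → (Ψ : Matrix (Fin n) (Fin n) ℝ) i j = 0 := fun i j hj =>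
    (mul_eq_zero.1 (mul_sub_eq_zero_of_laxMatrix_eq_diagonal h i j)).resolve_right
      (sub_ne_zero.2 fun e => hj (hlam (e.trans (hm i))))
  have hinj : Function.Injective w := by
    intro i k hik
    by_contra hne
    have := Ψ.sum_mul i k
    rw [if_neg hne, Finset.sum_eq_single (w i) (fun j _ hj => by rw [hz i j hj, zero_mul])
      (by simp)] at this
    exact mul_ne_zero (hw i) (hik ▸ hw k) this
  refine ⟨Equiv.ofBijective w (Finite.injective_iff_bijective.1 hinj), ?_⟩
  rw [h]
  congr 1
  funext i
  exact hm i

lemma todaField_eq_zero_iff {n : ℕ} {lam : Fin n → ℝ} {Ψ : SO n} :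
    todaField lam Ψ = 0 ↔ (laxMatrix lam Ψ).IsDiag := by
  have h1 : todaField lam Ψ = 0 ↔ antisymmetrization (laxMatrix lam Ψ) = 0 := by
    rw [todaField, neg_eq_zero]
    refine ⟨fun h => ?_, fun h => by rw [h, Matrix.zero_mul]⟩
    have := congrArg (· * (Ψ : Matrix (Fin n) (Fin n) ℝ)ᵀ) h
    simpa [Matrix.mul_assoc, Ψ.mul_transpose] using this
  rw [h1]
  constructor
  · intro h i j hij
    have h2 := congrFun (congrFun h i) j
    simp only [antisymmetrization, Matrix.of_apply, Matrix.zero_apply] at h2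
    rcases lt_or_gt_of_ne hij with h | h
    · simpa [h] using h2
    · simpa [h, h.not_gt] using h2
  · intro h
    ext i j
    simp only [antisymmetrization, Matrix.of_apply, Matrix.zero_apply]
    split_ifs with h1 h2
    · exact h h1.ne
    · rw [h h2.ne', neg_zero]
    · rfl

lemma exists_equiv_singularPoints {n : ℕ} {lam : Fin n → ℝ} (hlam : Function.Injective lam) :
    ∃ e : Equiv.Perm (Fin n) ≃ singularPoints lam, ∀ (w : Equiv.Perm (Fin n)) (Ψ : SO n),
      (Ψ : FlagManifold n) = (e w : FlagManifold n) ↔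
        ∀ i j, |(Ψ : Matrix (Fin n) (Fin n) ℝ) i j| = if j = w i then 1 else 0 := by
  choose P hP using exists_signed_permutation (n := n)
  have hmem : ∀ w, (P w : FlagManifold n) ∈ singularPoints lam := fun w =>
    ⟨P w, rfl, todaField_eq_zero_iff.2 (by
      rw [(laxMatrix_eq_diagonal_iff hlam).2 (hP w)]
      exact Matrix.isDiag_diagonal _)⟩
  have hbij : Function.Bijective (fun w => (⟨P w, hmem w⟩ : singularPoints lam)) := by
    constructor
    · intro w w' h
      have h1 : (P w : FlagManifold n) = (P w' : FlagManifold n) := congrArg Subtype.val h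
      rw [mk_eq_iff_abs_apply (hP w')] at h1
      ext i
      have h2 := h1 i (w i)
      rw [hP w, if_pos rfl] at h2
      by_contra hne
      rw [if_neg fun e => hne (congrArg Fin.val e)] at h2
      exact one_ne_zero h2
    · rintro ⟨x, Ψ, rfl, hΨ⟩
      rw [todaField_eq_zero_iff, Matrix.isDiag_iff_diagonal_diag] at hΨ
      obtain ⟨w, hw⟩ := exists_perm_of_laxMatrix_eq_diagonal hlam hΨ.symm
      refine ⟨w, Subtype.ext ?_⟩
      exact ((mk_eq_iff_abs_apply (hP w)).2 ((laxMatrix_eq_diagonal_iff hlam).1 hw)).symm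
  exact ⟨Equiv.ofBijective _ hbij, fun w Ψ => mk_eq_iff_abs_apply (hP w)⟩

end SpecialOrthogonal

/-! ### Completeness and time reversal of the flow -/

section Flow

open Matrix

/-- A bounded globally Lipschitz autonomous vector field has integral curves for all times. -/
lemma exists_global_integralCurve {E : Type*} [NormedAddCommGroup E] [NormedSpace ℝ E]
    [CompleteSpace E] {F : E → E} {K C : NNReal} (hF : LipschitzWith K F) (hC : ∀ x, ‖F x‖ ≤ C)
    (x₀ : E) : ∃ α : ℝ → E, α 0 = x₀ ∧ ∀ t, HasDerivAt α (F (α t)) t := by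
  have hloc : ∀ N : ℕ, ∃ α : ℝ → E, α 0 = x₀ ∧
      ∀ t ∈ Set.Ioo (-((N : ℝ) + 1)) (N + 1), HasDerivAt α (F (α t)) t := by
    intro N
    have h0 : (0 : ℝ) ∈ Set.Icc (-((N : ℝ) + 1)) (N + 1) := ⟨by linarith [N.cast_nonneg (α := ℝ)], by positivity⟩
    have hPL : IsPicardLindelof (fun _ => F) (⟨0, h0⟩ : Set.Icc (-((N : ℝ) + 1)) (N + 1)) x₀
        (C * (N + 1)) 0 C K :=
      { lipschitzOnWith := fun _ _ => hF.lipschitzOnWith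
        continuousOn := fun _ _ => continuousOn_const
        norm_le := fun _ _ x _ => hC x
        mul_max_le := by simp }
    obtain ⟨α, hα0, hα⟩ := hPL.exists_eq_forall_mem_Icc_hasDerivWithinAt
      (x := x₀) (by simp)
    exact ⟨α, hα0, fun t ht => (hα t (Set.Ioo_subset_Icc_self ht)).hasDerivAt
      (Icc_mem_nhds ht.1 ht.2)⟩
  choose α hα0 hα using hloc
  have hagree : ∀ N M : ℕ, N ≤ M → Set.EqOn (α N) (α M) (Set.Ioo (-((N : ℝ) + 1)) (N + 1)) := by
    intro N M hNM
    have hNM' : (N : ℝ) ≤ M := Nat.cast_le.2 hNM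
    refine ODE_solution_unique_of_mem_Ioo (v := fun _ => F) (s := fun _ => Set.univ) (K := K)
      (t₀ := 0) (fun _ _ => hF.lipschitzOnWith) ⟨by linarith [N.cast_nonneg (α := ℝ)], by positivity⟩
      (fun t ht => ⟨hα N t ht, trivial⟩)
      (fun t ht => ⟨hα M t ⟨?_, ?_⟩, trivial⟩) ((hα0 N).trans (hα0 M).symm)
    · linarith [ht.1]
    · linarith [ht.2]
  have hmem : ∀ t : ℝ, t ∈ Set.Ioo (-((⌊|t|⌋₊ : ℝ) + 1)) (⌊|t|⌋₊ + 1) := fun t =>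
    abs_lt.1 (Nat.lt_floor_add_one |t|)
  have hglue : ∀ (M : ℕ) (t : ℝ), t ∈ Set.Ioo (-((M : ℝ) + 1)) (M + 1) →
      α ⌊|t|⌋₊ t = α M t := by
    intro M t ht
    refine hagree _ _ ?_ (hmem t)
    have h1 : |t| < ((M + 1 : ℕ) : ℝ) := by
      push_cast
      exact abs_lt.2 ht
    exact Nat.lt_succ_iff.1 ((Nat.floor_lt (abs_nonneg t)).2 h1)
  refine ⟨fun t => α ⌊|t|⌋₊ t, by simp [hα0], fun t => ?_⟩
  refine (hα _ t (hmem t)).congr_of_eventuallyEq ?_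
  filter_upwards [Ioo_mem_nhds (hmem t).1 (hmem t).2] with s hs
  exact hglue _ s hs

/-- The Toda field as a polynomial field on the space of all matrices. -/
def todaExtension {n : ℕ} (lam : Fin n → ℝ) (X : Fin n → Fin n → ℝ) : Fin n → Fin n → ℝ :=
  fun i j => -∑ k, antisymmetrization (Matrix.of X * Matrix.diagonal lam * (Matrix.of X)ᵀ) i k * X k j

lemma contDiff_todaExtension {n : ℕ} (lam : Fin n → ℝ) : ContDiff ℝ 1 (todaExtension lam) := by
  have hent : ∀ i j : Fin n, ContDiff ℝ 1 (fun X : Fin n → Fin n → ℝ => X i j) := fun i j =>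
    contDiff_apply_apply ℝ ℝ i j
  have hlax : ∀ i k : Fin n, ContDiff ℝ 1 (fun X : Fin n → Fin n → ℝ =>
      (Matrix.of X * Matrix.diagonal lam * (Matrix.of X)ᵀ) i k) := by
    intro i k
    have he : ∀ X : Fin n → Fin n → ℝ,
        (Matrix.of X * Matrix.diagonal lam * (Matrix.of X)ᵀ) i k =
          ∑ l, X i l * lam l * X k l := fun X => by
      rw [Matrix.mul_apply]
      simp [Matrix.mul_diagonal]
    simp only [he]
    exact ContDiff.sum fun l _ => ((hent i l).mul contDiff_const).mul (hent k l)
  refine contDiff_pi.2 fun i => contDiff_pi.2 fun j => ?_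
  refine (ContDiff.sum fun k _ => ContDiff.mul ?_ (hent k j)).neg
  simp only [antisymmetrization, Matrix.of_apply]
  split_ifs
  · exact hlax i k
  · exact (hlax i k).neg
  · exact contDiff_const

lemma antisymmetrization_neg_symm {n : ℕ} {L : Matrix (Fin n) (Fin n) ℝ} (hL : Lᵀ = L)
    (i k : Fin n) : antisymmetrization L k i = -antisymmetrization L i k := by
  have : L k i = L i k := congrFun (congrFun hL i) k
  simp only [antisymmetrization, Matrix.of_apply]
  rcases lt_trichotomy i k with h | rfl | h
  · simp [h, h.not_gt, this]
  · simp
  · simp [h, h.not_gt, this]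

lemma todaField_eq_todaExtension {n : ℕ} (lam : Fin n → ℝ) (Ψ : SO n) (i j : Fin n) :
    todaField lam Ψ i j =
      todaExtension lam (fun i j => (Ψ : Matrix (Fin n) (Fin n) ℝ) i j) i j := by
  rw [todaField, Matrix.neg_apply, Matrix.mul_apply]
  rfl

lemma norm_le_one_of_mem_SO {n : ℕ} (Ψ : SO n) :
    ‖fun i j => (Ψ : Matrix (Fin n) (Fin n) ℝ) i j‖ ≤ 1 := by
  refine (pi_norm_le_iff_of_nonneg zero_le_one).2 fun i =>
    (pi_norm_le_iff_of_nonneg zero_le_one).2 fun j => ?_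
  exact Ψ.abs_apply_le_one i j

/-- The Toda flow on `SO n` is complete. -/
lemma exists_isTodaSolution {n : ℕ} (lam : Fin n → ℝ) (Ψ₀ : SO n) :
    ∃ Ψ : ℝ → SO n, IsTodaSolution lam Ψ ∧ Ψ 0 = Ψ₀ := by
  -- Entries of orthogonal matrices are at most 1 in absolute value, so the cutoff is 1 on `SO n` in
  -- the sup norm, while the truncated field is bounded and Lipschitz.
  let φ : ContDiffBump (0 : Fin n → Fin n → ℝ) := ⟨1, 2, one_pos, one_lt_two⟩
  let F : (Fin n → Fin n → ℝ) → Fin n → Fin n → ℝ := fun X => φ X • todaExtension lam X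
  have hFs : ContDiff ℝ 1 F := (φ.contDiff).smul (contDiff_todaExtension lam)
  have hFc : HasCompactSupport F := φ.hasCompactSupport.smul_right
  obtain ⟨K, hK⟩ := hFs.lipschitzWith_of_hasCompactSupport hFc one_ne_zero
  obtain ⟨C, hC⟩ := hFc.exists_bound_of_continuous hFs.continuous
  obtain ⟨X, hX0, hX⟩ := exists_global_integralCurve hK (C := C.toNNReal)
    (fun x => (hC x).trans (Real.le_coe_toNNReal C)) (fun i j => (Ψ₀ : Matrix (Fin n) (Fin n) ℝ) i j)
  have hent : ∀ t i j, HasDerivAt (fun s => X s i j) (φ (X t) * todaExtension lam (X t) i j) t :=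
    fun t i j => hasDerivAt_pi.1 (hasDerivAt_pi.1 (hX t) i) j
  -- `A` is antisymmetric and the cutoff is a scalar factor, so the Gram matrix of the columns is
  -- conserved even before the cutoff is known to be 1.
  have hgram : ∀ t i j, ∑ k, X t k i * X t k j = if i = j then 1 else 0 := by
    intro t i j
    have hd : ∀ t, HasDerivAt (fun s => ∑ k, X s k i * X s k j) 0 t := by
      intro t
      have h := HasDerivAt.fun_sum (u := Finset.univ) fun k _ => (hent t k i).mul (hent t k j)
      refine h.congr_deriv ?_
      set A := antisymmetrization (Matrix.of (X t) * Matrix.diagonal lam * (Matrix.of (X t))ᵀ)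
      have hA : ∀ k l, A l k = -A k l := antisymmetrization_neg_symm (by
        rw [Matrix.transpose_mul, Matrix.transpose_mul, Matrix.transpose_transpose,
          Matrix.diagonal_transpose, Matrix.mul_assoc])
      have hsum : ∑ k, todaExtension lam (X t) k i * X t k j =
          -∑ k, X t k i * todaExtension lam (X t) k j := by
        have h1 : ∀ k, todaExtension lam (X t) k i * X t k j =
            ∑ l, -(A k l * X t l i * X t k j) := fun k => by
          rw [Finset.sum_neg_distrib, ← Finset.sum_mul, ← neg_mul]
          rfl
        have h2 : ∀ k, X t k i * todaExtension lam (X t) k j =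
            ∑ l, -(A k l * X t k i * X t l j) := fun k => by
          rw [Finset.sum_neg_distrib]
          change X t k i * (-∑ l, A k l * X t l j) = _
          rw [mul_neg, Finset.mul_sum]
          congr 1
          exact Finset.sum_congr rfl fun l _ => by ring
        simp only [h1, h2]
        rw [Finset.sum_comm, ← Finset.sum_neg_distrib]
        refine Finset.sum_congr rfl fun k _ => ?_
        rw [← Finset.sum_neg_distrib]
        refine Finset.sum_congr rfl fun l _ => ?_
        rw [hA k l]
        ring
      have h3 : ∑ k, (φ (X t) * todaExtension lam (X t) k i * X t k j +
          X t k i * (φ (X t) * todaExtension lam (X t) k j)) =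
          φ (X t) * (∑ k, todaExtension lam (X t) k i * X t k j +
            ∑ k, X t k i * todaExtension lam (X t) k j) := by
        rw [← Finset.sum_add_distrib, Finset.mul_sum]
        exact Finset.sum_congr rfl fun k _ => by ring
      rw [h3, hsum, neg_add_cancel, mul_zero]
    have hconst := is_const_of_deriv_eq_zero (fun s => (hd s).differentiableAt)
      (fun s => (hd s).deriv) t 0
    rw [hconst, hX0]
    have := congrFun (congrFun Ψ₀.transpose_mul i) j
    rwa [Matrix.mul_apply, Matrix.one_apply] at this
  have horth : ∀ t, Matrix.of (X t) * (Matrix.of (X t))ᵀ = 1 := by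
    intro t
    rw [mul_eq_one_comm]
    ext i j
    rw [Matrix.mul_apply, Matrix.one_apply]
    exact hgram t i j
  have hXc : Continuous fun t => Matrix.of (X t) := by
    refine continuous_matrix fun i j => ?_
    exact continuous_iff_continuousAt.2 fun t => (hent t i j).continuousAt
  have hdet : ∀ t, (Matrix.of (X t)).det = 1 := by
    have hsq : ∀ t, (Matrix.of (X t)).det * (Matrix.of (X t)).det = 1 := fun t => by
      have := congrArg Matrix.det (horth t)
      rwa [det_mul, det_transpose, det_one] at this
    have h0 : (Matrix.of (X 0)).det = 1 := by
      rw [hX0]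
      exact Ψ₀.det_eq_one
    intro t
    have := isPreconnected_univ.eq_of_sq_eq (f := fun t => (Matrix.of (X t)).det)
      (g := fun _ : ℝ => (1 : ℝ)) (S := Set.univ)
      hXc.matrix_det.continuousOn continuousOn_const
      (fun t _ => by simpa [sq] using hsq t) (fun _ => one_ne_zero) (Set.mem_univ 0) h0
    exact this (Set.mem_univ t)
  refine ⟨fun t => ⟨Matrix.of (X t), mem_specialOrthogonalGroup_of_mul_transpose (horth t) (hdet t)⟩,
    fun t i j => ?_, Subtype.ext ?_⟩
  · refine (hent t i j).congr_deriv ?_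
    rw [todaField_eq_todaExtension]
    have hφ : φ (X t) = 1 := φ.one_of_mem_closedBall (mem_closedBall_zero_iff.2
      (norm_le_one_of_mem_SO
        ⟨Matrix.of (X t), mem_specialOrthogonalGroup_of_mul_transpose (horth t) (hdet t)⟩))
    rw [hφ, one_mul]
    rfl
  · exact congrArg Matrix.of hX0

lemma IsTodaSolution.reverse {n : ℕ} {lam : Fin n → ℝ} {Ψ : ℝ → SO n}
    (h : IsTodaSolution lam Ψ) : IsTodaSolution (-lam) fun t => Ψ (-t) := by
  intro t i j
  refine ((h (-t) i j).comp t (hasDerivAt_neg t)).congr_deriv ?_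
  have hlax : laxMatrix (-lam) (Ψ (-t)) = -laxMatrix lam (Ψ (-t)) := by
    ext i k
    rw [Matrix.neg_apply, laxMatrix_apply, laxMatrix_apply, ← Finset.sum_neg_distrib]
    exact Finset.sum_congr rfl fun _ _ => by simp
  have hanti : ∀ L : Matrix (Fin n) (Fin n) ℝ, antisymmetrization (-L) = -antisymmetrization L := by
    intro L
    ext i k
    simp only [antisymmetrization, Matrix.of_apply, Matrix.neg_apply]
    split_ifs <;> simp
  simp [todaField, hlax, hanti]

/-! ### Triangular factorisation and limits of trajectories -/

lemma eq_zero_of_hasDerivAt_mul {a g : ℝ → ℝ} {C : NNReal} (ha : ∀ t, |a t| ≤ C)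
    (hg : ∀ t, HasDerivAt g (a t * g t) t) (h0 : g 0 = 0) (t : ℝ) : g t = 0 := by
  refine congrFun (ODE_solution_unique_univ (v := fun t x => a t * x) (K := C)
    (s := fun _ => Set.univ) (t₀ := 0) (fun t => ?_) (fun t => ⟨hg t, trivial⟩)
    (g := fun _ => 0) (fun t => ⟨by simpa using hasDerivAt_const t (0 : ℝ), trivial⟩) h0) t
  refine LipschitzWith.lipschitzOnWith (LipschitzWith.of_dist_le_mul fun x y => ?_)
  rw [Real.dist_eq, Real.dist_eq, ← mul_sub, abs_mul]
  exact mul_le_mul_of_nonneg_right (ha t) (abs_nonneg _)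

/-- The upper triangular matrix `R` with `-A(L) = L - R`. -/
def upperPart {n : ℕ} (L : Matrix (Fin n) (Fin n) ℝ) : Matrix (Fin n) (Fin n) ℝ :=
  Matrix.of fun i j => if i < j then 2 * L i j else if j < i then 0 else L i j

lemma todaField_eq_sub {n : ℕ} (lam : Fin n → ℝ) (Ψ : SO n) (i j : Fin n) :
    todaField lam Ψ i j = (Ψ : Matrix (Fin n) (Fin n) ℝ) i j * lam j -
      ∑ l, upperPart (laxMatrix lam Ψ) i l * (Ψ : Matrix (Fin n) (Fin n) ℝ) l j := by
  have h : -antisymmetrization (laxMatrix lam Ψ) = laxMatrix lam Ψ - upperPart (laxMatrix lam Ψ) := by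
    ext i k
    simp only [antisymmetrization, upperPart, Matrix.of_apply, Matrix.neg_apply, Matrix.sub_apply]
    split_ifs with h1 h2
    · ring
    · ring
    · ring
  rw [todaField, ← Matrix.neg_mul, h, Matrix.sub_mul, laxMatrix_mul, Matrix.sub_apply,
    Matrix.mul_diagonal, Matrix.mul_apply]

lemma abs_laxMatrix_diag_le {n : ℕ} (lam : Fin n → ℝ) (Ψ : SO n) (i : Fin n) :
    |laxMatrix lam Ψ i i| ≤ ∑ j, |lam j| := by
  rw [laxMatrix_apply]
  refine (Finset.abs_sum_le_sum_abs _ _).trans (Finset.sum_le_sum fun j _ => ?_)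
  rw [abs_mul, abs_mul]
  have h := Ψ.abs_apply_le_one i j
  have h0 := abs_nonneg ((Ψ : Matrix (Fin n) (Fin n) ℝ) i j)
  have h1 := abs_nonneg (lam j)
  nlinarith [mul_le_mul h h h0 zero_le_one]

/-- The triangular factor in `Ψ t = G t * Ψ 0 * exp (t Λ)`. -/
lemma IsTodaSolution.blockTriangular_factor {n : ℕ} {lam : Fin n → ℝ} {Ψ : ℝ → SO n}
    (h : IsTodaSolution lam Ψ) (t : ℝ) :
    ((Ψ t : Matrix (Fin n) (Fin n) ℝ) * Matrix.diagonal (fun k => Real.exp (-(t * lam k))) *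
      (Ψ 0 : Matrix (Fin n) (Fin n) ℝ)ᵀ).BlockTriangular id := by
  let G : ℝ → Fin n → Fin n → ℝ := fun t i j => ∑ k, (Ψ t : Matrix (Fin n) (Fin n) ℝ) i k *
    Real.exp (-(t * lam k)) * (Ψ 0 : Matrix (Fin n) (Fin n) ℝ) j k
  have hG : ∀ t i j, HasDerivAt (fun s => G s i j)
      (-∑ l, upperPart (laxMatrix lam (Ψ t)) i l * G t l j) t := by
    intro t i j
    have hexp : ∀ k, HasDerivAt (fun s => Real.exp (-(s * lam k)))
        (Real.exp (-(t * lam k)) * -lam k) t := fun k =>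
      (((hasDerivAt_id t).mul_const (lam k)).neg.exp).congr_deriv (by simp)
    refine (HasDerivAt.fun_sum (u := Finset.univ) fun k _ =>
      ((h t i k).mul (hexp k)).mul_const _).congr_deriv ?_
    simp only [todaField_eq_sub, G, Finset.mul_sum]
    rw [Finset.sum_comm, ← Finset.sum_neg_distrib]
    refine Finset.sum_congr rfl fun k _ => ?_
    simp only [← mul_assoc, ← Finset.sum_mul]
    ring
  have hG0 : ∀ i j, G 0 i j = if i = j then 1 else 0 := fun i j => by
    simpa [G] using (Ψ 0).sum_mul i j
  -- `G' = -R G` with `R` upper triangular and `G 0 = 1`. Working up from the bottom row, each entry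
  -- below the diagonal solves a scalar linear equation with zero initial value.
  have key : ∀ N : ℕ, ∀ i j : Fin n, n - i < N → j < i → ∀ t, G t i j = 0 := by
    intro N
    induction N with
    | zero => intro i j h; omega
    | succ N ih =>
      intro i j hN hji
      refine eq_zero_of_hasDerivAt_mul (a := fun t => -laxMatrix lam (Ψ t) i i)
        (C := (∑ j, |lam j|).toNNReal) (fun t => ?_) (fun t => (hG t i j).congr_deriv ?_) ?_
      · rw [abs_neg]
        exact (abs_laxMatrix_diag_le lam (Ψ t) i).trans (Real.le_coe_toNNReal _)
      · rw [Finset.sum_eq_single i]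
        · simp [upperPart]
        · intro l _ hl
          rcases lt_or_gt_of_ne hl with h' | h'
          · simp [upperPart, h', h'.not_gt]
          · rw [ih l j (by omega) (hji.trans h') t, mul_zero]
        · simp
      · rw [hG0, if_neg hji.ne']
  intro i j hij
  rw [Matrix.mul_apply]
  simp only [Matrix.mul_diagonal, Matrix.transpose_apply]
  exact key _ i j (Nat.lt_succ_self _) hij t

instance SO.compactSpace {n : ℕ} : CompactSpace (SO n) := by
  refine isCompact_iff_compactSpace.1 ?_
  have hbox : IsCompact (Set.pi Set.univ fun _ : Fin n => Set.pi Set.univ fun _ : Fin n =>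
      Set.Icc (-1 : ℝ) 1) := isCompact_univ_pi fun _ => isCompact_univ_pi fun _ => isCompact_Icc
  have hclosed : IsClosed {A : Matrix (Fin n) (Fin n) ℝ | A * Aᵀ = 1 ∧ A.det = 1} :=
    (isClosed_eq (continuous_id.matrix_mul continuous_id.matrix_transpose)
      continuous_const).inter (isClosed_eq continuous_id.matrix_det continuous_const)
  refine IsCompact.of_isClosed_subset (X := Matrix (Fin n) (Fin n) ℝ) hbox ?_ ?_
  · convert hclosed using 1
    ext A
    rw [SetLike.mem_coe, Matrix.mem_specialOrthogonalGroup_iff, Matrix.mem_orthogonalGroup_iff]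
    rfl
  · intro A hA i _ j _
    exact abs_le.1 (SO.abs_apply_le_one ⟨A, hA⟩ i j)

/-- An orthogonal upper triangular matrix is diagonal: its inverse is again upper triangular but is
also its transpose. -/
lemma SO.apply_eq_zero_of_upper {n : ℕ} (Q : SO n) {w : Equiv.Perm (Fin n)}
    (h : ((Q : Matrix (Fin n) (Fin n) ℝ).submatrix id w).BlockTriangular id) (i j : Fin n)
    (hj : j ≠ w i) : (Q : Matrix (Fin n) (Fin n) ℝ) i j = 0 := by
  set T := (Q : Matrix (Fin n) (Fin n) ℝ).submatrix id w with hT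
  have horth : T * Tᵀ = 1 := by
    rw [hT, Matrix.transpose_submatrix, Matrix.submatrix_mul_equiv, Q.mul_transpose,
      Matrix.submatrix_id_id]
  have hinv : T⁻¹ = Tᵀ := Matrix.inv_eq_right_inv horth
  have hlow : (Tᵀ).BlockTriangular id := by
    rw [← hinv]
    refine h.inv_of_isUnit_det (isUnit_iff_ne_zero.2 fun h0 => ?_)
    have := congrArg Matrix.det horth
    rw [det_mul, h0, zero_mul, det_one] at this
    exact zero_ne_one this
  have hne : w.symm j ≠ i := fun e => hj (by rw [← e, Equiv.apply_symm_apply])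
  have hval : T i (w.symm j) = (Q : Matrix (Fin n) (Fin n) ℝ) i j := by simp [hT]
  rw [← hval]
  rcases lt_or_gt_of_ne hne with h' | h'
  · exact h h'
  · exact hlow h'

/-- The limit of a trajectory is read off from the pivots of its initial point. -/
lemma IsTodaSolution.tendsto_atTop {n : ℕ} {lam : Fin n → ℝ} (hlam : Function.Injective lam)
    {Ψ : ℝ → SO n} (h : IsTodaSolution lam Ψ) {w : Equiv.Perm (Fin n)}
    (hw : HasPivots lam (Ψ 0 : Matrix (Fin n) (Fin n) ℝ) w) {x : FlagManifold n}
    (hx : ∀ Q : SO n,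
      (∀ i j, |(Q : Matrix (Fin n) (Fin n) ℝ) i j| = if j = w i then 1 else 0) →
        (Q : FlagManifold n) = x) :
    Tendsto (fun t => (Ψ t : FlagManifold n)) atTop (𝓝 x) := by
  obtain ⟨V, hV, hVd, hpiv⟩ := hw
  set X := V * (Ψ 0 : Matrix (Fin n) (Fin n) ℝ) with hX
  -- Rescaling row `i` of `X * exp(tΛ)` by its dominant exponential makes it converge to its pivot
  -- entry.
  let Y : ℝ → Matrix (Fin n) (Fin n) ℝ := fun t =>
    Matrix.of fun i j => Real.exp (t * (lam j - lam (w i))) * X i j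
  let Y' : Matrix (Fin n) (Fin n) ℝ := Matrix.of fun i j => if j = w i then X i j else 0
  have hY : Tendsto Y atTop (𝓝 Y') := by
    refine tendsto_pi_nhds.2 fun i => tendsto_pi_nhds.2 fun j => ?_
    change Tendsto (fun t => Real.exp (t * (lam j - lam (w i))) * X i j) atTop
      (𝓝 (if j = w i then X i j else 0))
    rcases lt_trichotomy (lam j) (lam (w i)) with hlt | heq | hgt
    · rw [if_neg fun e => by simp [e] at hlt]
      have := (Real.tendsto_exp_atBot.comp
        (tendsto_id.atTop_mul_const_of_neg (sub_neg.2 hlt))).mul_const (X i j)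
      simpa using this
    · rw [if_pos (hlam heq)]
      simp [heq]
    · rw [(hpiv i).2 j hgt]
      simp
  have hfac : ∀ t, ∃ H : Matrix (Fin n) (Fin n) ℝ, H.BlockTriangular id ∧
      (Ψ t : Matrix (Fin n) (Fin n) ℝ) = H * Y t := by
    intro t
    refine ⟨_, ((h.blockTriangular_factor t).mul (hV.inv_of_isUnit_det hVd)).mul
      (Matrix.blockTriangular_diagonal fun i => Real.exp (t * lam (w i))), ?_⟩
    have h1 : Matrix.diagonal (fun i => Real.exp (t * lam (w i))) * Y t =
        X * Matrix.diagonal (fun j => Real.exp (t * lam j)) := by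
      ext i j
      rw [Matrix.diagonal_mul, Matrix.mul_diagonal]
      change Real.exp (t * lam (w i)) * (Real.exp (t * (lam j - lam (w i))) * X i j) = _
      rw [← mul_assoc, ← Real.exp_add, mul_comm]
      ring_nf
    have h2 : Matrix.diagonal (fun k => Real.exp (-(t * lam k))) *
        Matrix.diagonal (fun j => Real.exp (t * lam j)) = 1 := by
      rw [Matrix.diagonal_mul_diagonal, ← Matrix.diagonal_one]
      congr 1
      funext k
      rw [← Real.exp_add]
      simp
    rw [Matrix.mul_assoc _ _ (Y t), h1, hX, Matrix.mul_assoc _ V⁻¹, ← Matrix.mul_assoc V⁻¹,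
      ← Matrix.mul_assoc V⁻¹, Matrix.nonsing_inv_mul _ hVd, Matrix.one_mul, Matrix.mul_assoc _ _ᵀ,
      ← Matrix.mul_assoc _ᵀ, (Ψ 0).transpose_mul, Matrix.one_mul, Matrix.mul_assoc, h2,
      Matrix.mul_one]
  -- The product is `det (Y t)` times the upper triangular factor. Using the adjugate avoids
  -- inverting `Y t` and bounding that factor, and the vanishing entries pass to the limit.
  have htri : ∀ t, ((Ψ t : Matrix (Fin n) (Fin n) ℝ) * (Y t).adjugate).BlockTriangular id := by
    intro t i j hij
    obtain ⟨H, hH, he⟩ := hfac t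
    rw [he, Matrix.mul_assoc, Matrix.mul_adjugate, Matrix.mul_smul, Matrix.mul_one,
      Matrix.smul_apply, hH hij, smul_zero]
  have hY'd : Y'.det ≠ 0 := by
    have : Y' = Matrix.diagonal (fun i => X i (w i)) *
        (1 : Matrix (Fin n) (Fin n) ℝ).submatrix w id := by
      ext i j
      rw [Matrix.diagonal_mul]
      by_cases hj : j = w i
      · simp [Y', hj, Matrix.one_apply]
      · simp [Y', hj, Ne.symm hj]
    rw [this, det_mul, det_diagonal, det_permute]
    refine mul_ne_zero (Finset.prod_ne_zero_iff.2 fun i _ => (hpiv i).1) ?_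
    simp
  -- The lift to `SO n` need not be shown to converge: by compactness each ultrafilter gives some
  -- limit `Q`, and every such `Q` lies in the class `x`.
  refine (tendsto_iff_ultrafilter _ _ _).2 fun 𝒢 h𝒢 => ?_
  obtain ⟨Q, hQ⟩ : ∃ Q : SO n, (𝒢.map Ψ : Filter (SO n)) ≤ 𝓝 Q := by
    obtain ⟨Q, -, hQ⟩ := isCompact_univ.ultrafilter_le_nhds (𝒢.map Ψ) (by simp)
    exact ⟨Q, hQ⟩
  have hΨ : Tendsto Ψ 𝒢 (𝓝 Q) := hQ
  have hΨ' : Tendsto (fun t => (Ψ t : Matrix (Fin n) (Fin n) ℝ)) 𝒢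
      (𝓝 (Q : Matrix (Fin n) (Fin n) ℝ)) := (continuous_subtype_val.tendsto Q).comp hΨ
  have hYG : Tendsto Y 𝒢 (𝓝 Y') := hY.mono_left h𝒢
  have hlim : Tendsto (fun t => (Ψ t : Matrix (Fin n) (Fin n) ℝ) * (Y t).adjugate) 𝒢
      (𝓝 ((Q : Matrix (Fin n) (Fin n) ℝ) * Y'.adjugate)) :=
    ((continuous_fst.matrix_mul continuous_snd.matrix_adjugate).tendsto
      ((Q : Matrix (Fin n) (Fin n) ℝ), Y')).comp (hΨ'.prodMk_nhds hYG)
  have hTtri : ((Q : Matrix (Fin n) (Fin n) ℝ) * Y'.adjugate).BlockTriangular id := by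
    intro i j hij
    refine tendsto_nhds_unique (tendsto_pi_nhds.1 (tendsto_pi_nhds.1 hlim i) j) ?_
    simp only [htri _ hij]
    exact tendsto_const_nhds
  have hQtri : ((Q : Matrix (Fin n) (Fin n) ℝ).submatrix id w).BlockTriangular id := by
    intro i k hik
    have h1 : Y'.det * (Q : Matrix (Fin n) (Fin n) ℝ) i (w k) =
        ((Q : Matrix (Fin n) (Fin n) ℝ) * Y'.adjugate * Y') i (w k) := by
      rw [Matrix.mul_assoc, Matrix.adjugate_mul, Matrix.mul_smul, Matrix.mul_one,
        Matrix.smul_apply, smul_eq_mul]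
    rw [Matrix.mul_apply, Finset.sum_eq_single k, hTtri hik, zero_mul] at h1
    · exact (mul_eq_zero.1 h1).resolve_left hY'd
    · intro l _ hl
      have : w k ≠ w l := fun e => hl (w.injective e).symm
      simp [Y', this]
    · simp
  have hfin := hx Q (Q.abs_apply_of_support (Q.apply_eq_zero_of_upper hQtri))
  rw [← hfin]
  exact (continuous_quotient_mk'.tendsto Q).comp hΨ

end Flow

/-! ### Trajectories between singular points and the Bruhat order -/

section Main

/-- Points `x w` of the flag manifold represented by the signed permutation matrices of `w`. -/
def RepresentsPermutations {n : ℕ} (x : Equiv.Perm (Fin n) → FlagManifold n) : Prop :=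
  ∀ (w : Equiv.Perm (Fin n)) (Ψ : SO n), (Ψ : FlagManifold n) = x w ↔
    ∀ i j, |(Ψ : Matrix (Fin n) (Fin n) ℝ) i j| = if j = w i then 1 else 0

lemma RepresentsPermutations.absEntry {n : ℕ} {x : Equiv.Perm (Fin n) → FlagManifold n}
    (hx : RepresentsPermutations x) (w : Equiv.Perm (Fin n)) (i j : Fin n) :
    FlagManifold.absEntry i j (x w) = if j = w i then 1 else 0 := by
  obtain ⟨Q, hQ⟩ := QuotientGroup.mk_surjective (x w)
  rw [← hQ]
  exact (hx w Q).1 hQ i j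

/-- The continuous functions `FlagManifold.absEntry` separate these points, so the Hausdorff
property of the flag manifold is not needed. -/
lemma RepresentsPermutations.eq_of_tendsto {n : ℕ} {x : Equiv.Perm (Fin n) → FlagManifold n}
    (hx : RepresentsPermutations x) {γ : ℝ → FlagManifold n} {l : Filter ℝ} [l.NeBot]
    {v w : Equiv.Perm (Fin n)} (hv : Tendsto γ l (𝓝 (x v))) (hw : Tendsto γ l (𝓝 (x w))) :
    v = w := by
  ext i
  have h := tendsto_nhds_unique
    (((FlagManifold.continuous_absEntry i (v i)).tendsto _).comp hv)
    (((FlagManifold.continuous_absEntry i (v i)).tendsto _).comp hw)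
  rw [hx.absEntry, hx.absEntry, if_pos rfl] at h
  by_contra hne
  rw [if_neg fun e => hne (congrArg Fin.val e)] at h
  exact one_ne_zero h

lemma IsTodaSolution.tendsto_atBot {n : ℕ} {lam : Fin n → ℝ} (hlam : Function.Injective lam)
    {Ψ : ℝ → SO n} (h : IsTodaSolution lam Ψ) {x : Equiv.Perm (Fin n) → FlagManifold n}
    (hx : RepresentsPermutations x) {w : Equiv.Perm (Fin n)}
    (hw : HasPivots (-lam) (Ψ 0 : Matrix (Fin n) (Fin n) ℝ) w) :
    Tendsto (fun t => (Ψ t : FlagManifold n)) atBot (𝓝 (x w)) := by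
  have := (h.reverse.tendsto_atTop (lam := -lam) (w := w) (neg_injective.comp hlam) (by simpa using hw)
    fun Q hQ => (hx w Q).2 hQ).comp tendsto_neg_atBot_atTop
  simpa [Function.comp_def] using this

lemma trajectoryFromTo_iff {n : ℕ} {lam : Fin n → ℝ} (hlam : Function.Injective lam)
    {x : Equiv.Perm (Fin n) → FlagManifold n} (hx : RepresentsPermutations x)
    {σ : Equiv.Perm (Fin n)} (hσ : StrictMono fun i => lam (σ i)) (u v : Equiv.Perm (Fin n)) :
    TrajectoryFromTo lam (x u) (x v) ↔ BruhatLE (σ⁻¹ * v) (σ⁻¹ * u) := by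
  constructor
  · rintro ⟨γ, ⟨Ψ, hΨ, hγ⟩, hbot, htop⟩
    obtain rfl : γ = fun t => (Ψ t : FlagManifold n) := funext hγ
    have hM : IsUnit (Ψ 0 : Matrix (Fin n) (Fin n) ℝ).det := by
      rw [(Ψ 0).det_eq_one]
      exact isUnit_one
    obtain ⟨v', hv'⟩ := exists_hasPivots hlam hM
    obtain ⟨u', hu'⟩ := exists_hasPivots (μ := -lam) (neg_injective.comp hlam) hM
    obtain rfl := hx.eq_of_tendsto htop
      (hΨ.tendsto_atTop hlam hv' fun Q hQ => (hx v' Q).2 hQ)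
    obtain rfl := hx.eq_of_tendsto hbot (hΨ.tendsto_atBot hlam hx hu')
    exact bruhatLE_of_hasPivots hσ hM hv' hu'
  · intro hle
    -- The matrix is built for the increasing weights `lam ∘ σ`; permuting its columns by `σ`
    -- restores the weights `lam` and turns `σ⁻¹ * v`, `σ⁻¹ * u` into `v`, `u`.
    obtain ⟨M, hM, hMv, hMu⟩ := exists_hasPivots_of_bruhatLE hσ hle
    have hv := HasPivots.submatrix (μ := lam) σ hMv
    have hu := HasPivots.submatrix (μ := -lam) σ hMu
    rw [mul_inv_cancel_left] at hv hu
    have hM' : IsUnit (M.submatrix id σ.symm).det := by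
      rw [Matrix.det_permute']
      exact IsUnit.mul (by
        rcases Int.units_eq_one_or (Equiv.Perm.sign σ.symm) with h | h <;> simp [h]) hM
    obtain ⟨U, hU, hUd, hmem⟩ := exists_upper_mul_mem_specialOrthogonalGroup hM'
    obtain ⟨Ψ, hΨ, hΨ0⟩ := exists_isTodaSolution lam ⟨_, hmem⟩
    have hcoe : (Ψ 0 : Matrix (Fin n) (Fin n) ℝ) = U * M.submatrix id σ.symm :=
      congrArg Subtype.val hΨ0
    refine ⟨fun t => (Ψ t : FlagManifold n), ⟨Ψ, hΨ, fun _ => rfl⟩, ?_, ?_⟩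
    · exact hΨ.tendsto_atBot hlam hx (hcoe ▸ hu.mul_left hU hUd)
    · exact hΨ.tendsto_atTop hlam (hcoe ▸ hv.mul_left hU hUd) fun Q hQ => (hx v Q).2 hQ

end Main

theorem theorem1 (n : ℕ) (lam : Fin n → ℝ) (hlam : Function.Injective lam) :
    ∃ e : Equiv.Perm (Fin n) ≃ singularPoints lam,
      (∀ (w : Equiv.Perm (Fin n)) (Ψ : SO n),
        ((Ψ : FlagManifold n) = (e w : FlagManifold n) ↔
          ∀ i j, |(Ψ : Matrix (Fin n) (Fin n) ℝ) i j| = if j = w i then 1 else 0) ∧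
        ((Ψ : FlagManifold n) = (e w : FlagManifold n) ↔
          laxMatrix lam Ψ = Matrix.diagonal (fun i => lam (w i)))) ∧
      ∃ σ : Equiv.Perm (Fin n), StrictMono (fun i => lam (σ i)) ∧
        ∀ u v : Equiv.Perm (Fin n),
          ConnectedByTrajectory lam (e u : FlagManifold n) (e v : FlagManifold n) ↔
            BruhatComparable (σ⁻¹ * u) (σ⁻¹ * v) := by
  obtain ⟨e, he⟩ := exists_equiv_singularPoints hlam
  refine ⟨e, fun w Ψ => ⟨he w Ψ, (he w Ψ).trans (laxMatrix_eq_diagonal_iff hlam).symm⟩,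
    Tuple.sort lam, (Tuple.monotone_sort lam).strictMono_of_injective
      (hlam.comp (Tuple.sort lam).injective), fun u v => ?_⟩
  have hσ : StrictMono fun i => lam (Tuple.sort lam i) :=
    (Tuple.monotone_sort lam).strictMono_of_injective (hlam.comp (Tuple.sort lam).injective)
  have hx : RepresentsPermutations fun w => (e w : FlagManifold n) := he
  rw [ConnectedByTrajectory, BruhatComparable, trajectoryFromTo_iff hlam hx hσ u v,
    trajectoryFromTo_iff hlam hx hσ v u, or_comm]
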